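/- Let $\Gamma$ be a finite single-player extensive-form game: a finite rooted tree whose nonterminal nodes $h$, with nonempty action sets $A_h$, belong either to chance (which plays a fixed distribution on $A_h$) or to the player; a payoff $u(z)\ge 0$ at every terminal node $z$; and a partition of the player's nodes into infosets $I$ such that all nodes of $I$ have the same action set $A_I$. Perfect recall is not assumed, and an infoset may be visited several times along one path. A (behavioral) strategy $\pi$ assigns to each infoset $I$ a distribution $\pi(\cdot\mid I)\in\Delta(A_I)$. Write $\mathbb P(h\mid\pi)$ for the probability of reaching node $h$ and $U(\pi)=\sum_z \mathbb P(z\mid\pi)\,u(z)$ for the expected utility, which is a polynomial in the numbers $\pi(a\mid I)$; let $\nabla_{I,a}U$ be its partial derivatives. Write $\pi^{I\mapsto\sigma}$ for the strategy that plays $\sigma$ at $I$ and $\pi$ elsewhere. Put $\mathbb P(I\mid\pi)=\sum_{h}\mathbb P(h\mid\pi)$ over those $h\in I$ that have no proper ancestor in $I$, and $\mathrm{Fr}(I\mid\pi)=\sum_{h\in I}\mathbb P(h\mid\pi)$. Two strategies are realization-equivalent if they reach every node with the same probability. * $\pi$ is an *EDT equilibrium* if $U(\pi^{I\mapsto\sigma})\le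 U(\pi)$ for all $I$ and $\sigma\in\Delta(A_I)$. It is a *CDT equilibrium* if it is a KKT point of maximizing $U$ over all strategies. * $\pi$ is *EDT-rational* if there are strategies $\pi^{(k)}\to\pi$ with $\pi^{(k)}(a\mid I)>0$ for all $I$ and $a\in A_I$, and numbers $\varepsilon^{(k)}>0$, $\varepsilon^{(k)}\to0$, such that for all $k$, all $I$ with $\mathbb P(I\mid\pi^{(k)})>0$ and all $\sigma\in\Delta(A_I)$, $$\frac{1}{\mathbb P(I\mid\pi^{(k)})}\Big(U\big((\pi^{(k)})^{I\mapsto\sigma}\big)-U(\pi^{(k)})\Big)\le\varepsilon^{(k)} .$$ It is *CDT-rational* if the same holds with $\mathbb P(I\mid\cdot)$ replaced by $\mathrm{Fr}(I\mid\cdot)$ and the difference in parentheses replaced by $\sum_{a\in A_I}(\sigma(a)-\pi^{(k)}(a\mid I))\,\nabla_{I,a}U(\pi^{(k)})$. * $\pi$ is an *EDT-Nash* (resp. *CDT-Nash*) equilibrium if it is an EDT (resp. CDT) equilibrium and is realization-equivalent to some EDT-rational (resp. CDT-rational) strategy. Let $\mathrm{pr}(\Gamma)$ be the coarsest perfect recall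 refinement of $\Gamma$: the same tree, chance probabilities and payoffs, but every infoset is split into classes of nodes with the same observation sequence, that is, the same sequence of pairs (infoset of $\Gamma$, action taken) along the player's nodes on the path from the root to (excluding) the node. For $\mathrm{SC}\in\{$worst CDT-Nash, best CDT-Nash, worst EDT-Nash, best EDT-Nash$\}$ let $u(\mathrm{SC}(\Gamma))$ be the minimum (worst) or maximum (best) of $U$ over the equilibria of that kind, and let $$\mathrm{VoR}^{\mathrm{SC}}(\Gamma)=\frac{u(\mathrm{SC}(\mathrm{pr}(\Gamma)))}{u(\mathrm{SC}(\Gamma))}\in[0,\infty],$$ which is $\infty$ if only the denominator vanishes. **Claim.** For every such $\Gamma$ and each of the four concepts $\mathrm{SC}$, the minima and maxima $u(\mathrm{SC}(\Gamma))$ and $u(\mathrm{SC}(\mathrm{pr}(\Gamma)))$ exist, and $u(\mathrm{SC}(\mathrm{pr}(\Gamma)))\ge u(\mathrm{SC}(\Gamma))$. Consequently $\mathrm{VoR}^{\mathrm{SC}}(\Gamma)\ge 1$ unless both utilities are $0$ (when the ratio $0/0$ is undefined). -/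

import Mathlib

open Filter Topology

universe u

/-- A finite rooted tree whose edges are labelled by actions. A node is the list of actions
leading to it from the root `[]`. -/
structure HistoryTree (A : Type u) where
  nodes : Finset (List A)
  root_mem : [] ∈ nodes
  prefix_closed : ∀ (h : List A) (a : A), h ++ [a] ∈ nodes → h ∈ nodes

namespace HistoryTree

variable {A : Type u} (T : HistoryTree A)

/-- The set `A_h` of actions available at the node `h`. -/
noncomputable def actions (h : List A) : Finset A :=
  T.nodes.preimage (fun a => h ++ [a]) (fun a _ b _ hab => by simpa using hab)

/-- The terminal nodes, that is, the leaves of the tree. -/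
noncomputable def terminals [DecidableEq A] : Finset (List A) :=
  T.nodes.filter fun h => T.actions h = ∅

/-- The nonterminal nodes. -/
noncomputable def nonterminals [DecidableEq A] : Finset (List A) :=
  T.nodes.filter fun h => T.actions h ≠ ∅

end HistoryTree

/-- A game tree for one strategic player: a finite rooted tree, the set of nodes at which chance
moves, and a probability distribution over the available actions at each chance node. -/
structure GameTree (A : Type u) [DecidableEq A] extends HistoryTree A where
  chanceNodes : Finset (List A)
  chance_subset : chanceNodes ⊆ toHistoryTree.nonterminals
  chanceProb : List A → A → ℝ
  chance_nonneg : ∀ h ∈ chanceNodes, ∀ a ∈ toHistoryTree.actions h, 0 ≤ chanceProb h a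
  chance_sum : ∀ h ∈ chanceNodes, ∑ a ∈ toHistoryTree.actions h, chanceProb h a = 1

/-- The nodes at which the strategic player moves: the nonterminal nodes not assigned to chance. -/
noncomputable def GameTree.decisionNodes {A : Type u} [DecidableEq A] (T : GameTree A) :
    Finset (List A) :=
  T.nonterminals \ T.chanceNodes

/-- A finite single-player extensive-form game, possibly with imperfect recall. -/
structure SinglePlayerGame (A : Type u) [DecidableEq A] extends GameTree A where
  /-- The payoff; only its values at terminal nodes matter. -/
  payoff : List A → ℝ
  payoff_nonneg : ∀ z ∈ toGameTree.terminals, 0 ≤ payoff z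
  /-- The partition of the player's nodes into information sets. -/
  infosets : Finpartition toGameTree.decisionNodes
  actions_eq : ∀ I ∈ infosets.parts, ∀ h ∈ I, ∀ h' ∈ I,
    toGameTree.actions h = toGameTree.actions h'

namespace SinglePlayerGame

variable {A : Type u} [DecidableEq A] (Γ : SinglePlayerGame A)

/-- The type of information sets of the game. -/
abbrev Infoset : Type u := {I : Finset (List A) // I ∈ Γ.infosets.parts}

/-- The information set containing a given decision node. -/
noncomputable def infosetOf (h : List A) (hh : h ∈ Γ.decisionNodes) : Γ.Infoset :=
  ⟨Γ.infosets.part h, Γ.infosets.part_mem.2 hh⟩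

/-- The action set `A_I`: the common action set of all nodes of the information set `I`. -/
noncomputable def actionsAt (I : Γ.Infoset) : Finset A :=
  I.1.biUnion Γ.actions

/-- The part of the observation sequence contributed by the actions `l` taken from the node `h`
on: the pairs (information set, action) at the player's own nodes, in order. -/
noncomputable def obsFrom : List A → List A → List (Finset (List A) × A)
  | _, [] => []
  | h, a :: l =>
      if h ∈ Γ.decisionNodes then (Γ.infosets.part h, a) :: obsFrom (h ++ [a]) l
      else obsFrom (h ++ [a]) l

/-- `obs₁(h)`: the sequence of pairs (information set, action) at the player's own nodes on the
path from the root to `h`, with `h` excluded. -/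
noncomputable def obs (h : List A) : List (Finset (List A) × A) :=
  Γ.obsFrom [] h

/-- Nodes are compared by their information set and by their observation sequence. -/
noncomputable def recallSetoid : Setoid (List A) :=
  Setoid.ker fun h => (Γ.infosets.part h, Γ.obs h)

noncomputable instance : DecidableRel Γ.recallSetoid.r := Classical.decRel _

/-- The coarsest perfect recall refinement: same game tree and payoffs, and each information set
is split into the classes of nodes with equal observation sequences. -/
noncomputable def perfectRecall : SinglePlayerGame A where
  toGameTree := Γ.toGameTree
  payoff := Γ.payoff
  payoff_nonneg := Γ.payoff_nonneg
  infosets := Finpartition.ofSetSetoid Γ.recallSetoid Γ.decisionNodes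
  actions_eq := by
    intro I hI h hh h' hh'
    obtain ⟨g, hg, rfl⟩ := Finset.mem_image.1 hI
    rw [Finset.mem_filter] at hh hh'
    have e : Γ.infosets.part g = Γ.infosets.part h := congrArg Prod.fst hh.2
    have e' : Γ.infosets.part g = Γ.infosets.part h' := congrArg Prod.fst hh'.2
    refine Γ.actions_eq _ (Γ.infosets.part_mem.2 hg) h ?_ h' ?_
    · rw [e]; exact Γ.infosets.mem_part hh.1
    · rw [e']; exact Γ.infosets.mem_part hh'.1

/-- The randomized actions `Δ(A_I)` at the information set `I`. -/
def IsRandomizedAction (I : Γ.Infoset) (σ : A → ℝ) : Prop :=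
  (∀ a, 0 ≤ σ a) ∧ (∀ a, a ∉ Γ.actionsAt I → σ a = 0) ∧ ∑ a ∈ Γ.actionsAt I, σ a = 1

/-- `π` is a behavioral strategy. -/
def IsStrategy (π : Γ.Infoset → A → ℝ) : Prop :=
  ∀ I, Γ.IsRandomizedAction I (π I)

/-- The probability (under `π` or under chance) of the action `a` at the nonterminal node `h`. -/
noncomputable def stepProb (π : Γ.Infoset → A → ℝ) (h : List A) (a : A) : ℝ :=
  if hh : h ∈ Γ.decisionNodes then π (Γ.infosetOf h hh) a else Γ.chanceProb h a

/-- The product of the probabilities of the successive actions `l`, starting from the node `h`. -/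
noncomputable def probFrom (π : Γ.Infoset → A → ℝ) : List A → List A → ℝ
  | _, [] => 1
  | h, a :: l => Γ.stepProb π h a * probFrom π (h ++ [a]) l

/-- The reach probability `ℙ(h ∣ π)` of the node `h` from the root. -/
noncomputable def reachProb (π : Γ.Infoset → A → ℝ) (h : List A) : ℝ :=
  Γ.probFrom π [] h

/-- The expected utility. It is a polynomial in the values of `π`, hence defined for all real
values and not only for strategies. -/
noncomputable def utility (π : Γ.Infoset → A → ℝ) : ℝ :=
  ∑ z ∈ Γ.terminals, Γ.reachProb π z * Γ.payoff z

/-- Two strategies are realization-equivalent if they reach each node equally likely. -/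
def RealizationEquiv (π π' : Γ.Infoset → A → ℝ) : Prop :=
  ∀ h ∈ Γ.nodes, Γ.reachProb π h = Γ.reachProb π' h

/-- The strategy that plays `σ` at `I` and follows `π` elsewhere. -/
noncomputable def deviate (π : Γ.Infoset → A → ℝ) (I : Γ.Infoset) (σ : A → ℝ) :
    Γ.Infoset → A → ℝ :=
  Function.update π I σ

/-- The partial derivative of the expected utility with respect to the coordinate `π(a ∣ I)`. -/
noncomputable def utilityDeriv (π : Γ.Infoset → A → ℝ) (I : Γ.Infoset) (a : A) : ℝ :=
  deriv (fun t : ℝ => Γ.utility (Γ.deviate π I (Function.update (π I) a t))) (π I a)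

/-- The nodes of `I` at which `I` is entered for the first time: no proper ancestor is in `I`. -/
noncomputable def firstNodes (I : Γ.Infoset) : Finset (List A) :=
  I.1.filter fun h => ∀ h' ∈ I.1, h' <+: h → h' = h

/-- The reach probability `ℙ(I ∣ π)` of an information set. -/
noncomputable def infosetProb (π : Γ.Infoset → A → ℝ) (I : Γ.Infoset) : ℝ :=
  ∑ h ∈ Γ.firstNodes I, Γ.reachProb π h

/-- The visit frequency `Fr(I ∣ π)` of an information set. -/
noncomputable def frequency (π : Γ.Infoset → A → ℝ) (I : Γ.Infoset) : ℝ :=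
  ∑ h ∈ I.1, Γ.reachProb π h

/-- The CDT utility of deviating to `σ` at `I`: the first-order approximation at `π` of the
expected utility. -/
noncomputable def cdtUtility (σ : A → ℝ) (π : Γ.Infoset → A → ℝ) (I : Γ.Infoset) : ℝ :=
  Γ.utility π + ∑ a ∈ Γ.actionsAt I, (σ a - π I a) * Γ.utilityDeriv π I a

/-- EDT equilibrium: no randomized action at a single information set improves on `π`. -/
def IsEDTEquilibrium (π : Γ.Infoset → A → ℝ) : Prop :=
  Γ.IsStrategy π ∧ ∀ I σ, Γ.IsRandomizedAction I σ →
    Γ.utility (Γ.deviate π I σ) ≤ Γ.utility π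

/-- CDT equilibrium: `π` is a KKT point of maximizing the expected utility subject to
`π(a ∣ I) ≥ 0` (multipliers `μ`) and `∑ a, π(a ∣ I) = 1` (multipliers `lam`). -/
def IsCDTEquilibrium (π : Γ.Infoset → A → ℝ) : Prop :=
  Γ.IsStrategy π ∧ ∃ (lam : Γ.Infoset → ℝ) (μ : Γ.Infoset → A → ℝ),
    ∀ I, ∀ a ∈ Γ.actionsAt I,
      0 ≤ μ I a ∧ μ I a * π I a = 0 ∧ Γ.utilityDeriv π I a + μ I a = lam I

/-- `π` is the limit of the strategies `p k`, which play every available action with positive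
probability, and `ε k > 0` tends to `0`. -/
def IsTrembleSequence (π : Γ.Infoset → A → ℝ) (p : ℕ → Γ.Infoset → A → ℝ) (ε : ℕ → ℝ) : Prop :=
  (∀ k, Γ.IsStrategy (p k)) ∧ (∀ k I, ∀ a ∈ Γ.actionsAt I, 0 < p k I a) ∧
  (∀ I a, Tendsto (fun k => p k I a) atTop (𝓝 (π I a))) ∧
  (∀ k, 0 < ε k) ∧ Tendsto ε atTop (𝓝 0)

/-- EDT sequential rationality. -/
def IsEDTRational (π : Γ.Infoset → A → ℝ) : Prop :=
  Γ.IsStrategy π ∧ ∃ p ε, Γ.IsTrembleSequence π p ε ∧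
    ∀ k I, 0 < Γ.infosetProb (p k) I → ∀ σ, Γ.IsRandomizedAction I σ →
      1 / Γ.infosetProb (p k) I * (Γ.utility (Γ.deviate (p k) I σ) - Γ.utility (p k)) ≤ ε k

/-- CDT sequential rationality. -/
def IsCDTRational (π : Γ.Infoset → A → ℝ) : Prop :=
  Γ.IsStrategy π ∧ ∃ p ε, Γ.IsTrembleSequence π p ε ∧
    ∀ k I, 0 < Γ.frequency (p k) I → ∀ σ, Γ.IsRandomizedAction I σ →
      1 / Γ.frequency (p k) I * (Γ.cdtUtility σ (p k) I - Γ.utility (p k)) ≤ ε k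

/-- EDT-Nash equilibrium. -/
def IsEDTNash (π : Γ.Infoset → A → ℝ) : Prop :=
  Γ.IsEDTEquilibrium π ∧ ∃ π', Γ.IsEDTRational π' ∧ Γ.RealizationEquiv π π'

/-- CDT-Nash equilibrium. -/
def IsCDTNash (π : Γ.Infoset → A → ℝ) : Prop :=
  Γ.IsCDTEquilibrium π ∧ ∃ π', Γ.IsCDTRational π' ∧ Γ.RealizationEquiv π π'

end SinglePlayerGame

/-- The four solution concepts: worst or best outcome under CDT-Nash or EDT-Nash. -/
inductive SolutionConcept where
  | worstCDTNash
  | bestCDTNash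
  | worstEDTNash
  | bestEDTNash

namespace SinglePlayerGame

variable {A : Type u} [DecidableEq A] (Γ : SinglePlayerGame A)

/-- The utilities of the CDT-Nash equilibria. -/
def cdtNashOutcomes : Set ℝ := {v | ∃ π, Γ.IsCDTNash π ∧ Γ.utility π = v}

/-- The utilities of the EDT-Nash equilibria. -/
def edtNashOutcomes : Set ℝ := {v | ∃ π, Γ.IsEDTNash π ∧ Γ.utility π = v}

/-- `v` is the utility `u₁(SC(Γ))` under the solution concept `SC`: the smallest (worst) or
largest (best) utility of an equilibrium of the given kind. -/
def IsOutcome (v : ℝ) : SolutionConcept → Prop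
  | .worstCDTNash => IsLeast Γ.cdtNashOutcomes v
  | .bestCDTNash => IsGreatest Γ.cdtNashOutcomes v
  | .worstEDTNash => IsLeast Γ.edtNashOutcomes v
  | .bestEDTNash => IsGreatest Γ.edtNashOutcomes v

/-- The utility `u₁(SC(Γ))`; it is meaningful when it satisfies `IsOutcome`. -/
noncomputable def outcome : SolutionConcept → ℝ
  | .worstCDTNash => sInf Γ.cdtNashOutcomes
  | .bestCDTNash => sSup Γ.cdtNashOutcomes
  | .worstEDTNash => sInf Γ.edtNashOutcomes
  | .bestEDTNash => sSup Γ.edtNashOutcomes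

/-- The value of recall `u₁(SC(pr₁(Γ))) / u₁(SC(Γ))`, equal to `∞` if only the denominator is zero.
The case `0 / 0` carries no meaning. -/
noncomputable def valueOfRecall (SC : SolutionConcept) : ENNReal :=
  ENNReal.ofReal (Γ.perfectRecall.outcome SC) / ENNReal.ofReal (Γ.outcome SC)

end SinglePlayerGame

/-!
Three arguments carry the proof.

*The performance difference formula* (`utility_sub`): for arbitrary `τ` and `π`, the difference
`U(τ) - U(π)` is the sum over the decision nodes `h`, weighted with the probability of reaching `h`
under `τ`, of the gain from playing one step of `τ` at `h` and `π` from then on. It follows by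
telescoping along the path to each terminal node. It yields the gain of a deviation at a single
infoset, the partial derivatives of the utility (`utilityDeriv_eq`), and the first-order gain
(`cdtUtility_sub`), all in terms of the continuation values `valueFrom`.

*Existence and compactness.* Maximize the utility over the strategies that tremble uniformly with
probability `δ`. At the maximizer no trembling deviation helps, and replacing a deviation by its
trembling version costs at most `δ` times the sum of payoffs at each visit. Since the number of
visits is bounded, the gains relative to the reach probability or the visit frequency of the infoset
are of order `δ` (`exists_isApproxEDT_isApproxCDT`). The rational strategies form an intersection of
closures inside the compact set of strategies (`isTrembleLimit_iff`), so they exist and form a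
compact set. Rational strategies are equilibria, and equilibria form a closed set, so the Nash
outcomes form a nonempty compact set of reals, which has a least and a greatest element
(`isOutcome_outcome`).

*Perfect recall.* In the refinement, the nodes of an infoset share their observation sequence.
Passing from a fully mixed `π` to any `τ` therefore multiplies all their reach probabilities by one
common factor (`likelihoodRatio_perfectRecall`), and the performance difference formula becomes a
nonnegative combination of first-order gains at single infosets, which are small relative to the
visit frequency when `π` is approximately rational. In the limit, every CDT-rational strategy is a
global maximizer of the utility; EDT and CDT rationality agree because no path visits an infoset
twice. So all four outcomes of the refinement equal the largest utility of any strategy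
(`utility_le_outcome_perfectRecall`). Strategies of the original game are strategies of the
refinement with the same utility, so this bounds every outcome of the original game.
-/

namespace SinglePlayerGame

variable {A : Type u} [DecidableEq A] (Γ : SinglePlayerGame A)

/-! ### Reach probabilities along the tree -/

lemma mem_actions {h : List A} {a : A} : a ∈ Γ.actions h ↔ h ++ [a] ∈ Γ.nodes :=
  Finset.mem_preimage

lemma mem_nodes_of_prefix {h g : List A} (hg : g ∈ Γ.nodes) (hp : h <+: g) : h ∈ Γ.nodes := by
  obtain ⟨l, rfl⟩ := hp
  induction l using List.reverseRecOn with
  | nil => simpa using hg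
  | append_singleton l a ih =>
    exact ih (Γ.prefix_closed _ a (by simpa [List.append_assoc] using hg))

lemma mem_nodes_of_mem_decisionNodes {h : List A} (hh : h ∈ Γ.decisionNodes) : h ∈ Γ.nodes := by
  simp only [GameTree.decisionNodes, HistoryTree.nonterminals, Finset.mem_sdiff,
    Finset.mem_filter] at hh
  exact hh.1.1

lemma mem_nodes_of_mem_terminals {z : List A} (hz : z ∈ Γ.terminals) : z ∈ Γ.nodes :=
  (Finset.mem_filter.1 hz).1

/-- A node with an available action that is not a decision node is a chance node. -/
lemma mem_chanceNodes {h : List A} {a : A} (ha : h ++ [a] ∈ Γ.nodes) (hh : h ∉ Γ.decisionNodes) :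
    h ∈ Γ.chanceNodes := by
  by_contra hc
  refine hh ?_
  simp only [GameTree.decisionNodes, HistoryTree.nonterminals, Finset.mem_sdiff,
    Finset.mem_filter]
  refine ⟨⟨Γ.prefix_closed _ _ ha, ?_⟩, hc⟩
  exact Finset.ne_empty_of_mem (Γ.mem_actions.2 ha)

lemma infoset_subset (I : Γ.Infoset) : I.1 ⊆ Γ.decisionNodes :=
  Γ.infosets.le I.2

lemma infosetOf_eq_iff {h : List A} (hh : h ∈ Γ.decisionNodes) {I : Γ.Infoset} :
    Γ.infosetOf h hh = I ↔ h ∈ I.1 := by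
  rw [← Γ.infosets.part_eq_iff_mem I.2, infosetOf, Subtype.ext_iff]

lemma actionsAt_eq {I : Γ.Infoset} {h : List A} (hh : h ∈ I.1) :
    Γ.actionsAt I = Γ.actions h := by
  ext a
  simp only [actionsAt, Finset.mem_biUnion]
  constructor
  · rintro ⟨g, hg, ha⟩
    rwa [Γ.actions_eq I.1 I.2 h hh g hg]
  · exact fun ha => ⟨h, hh, ha⟩

lemma infoset_nonempty (I : Γ.Infoset) : I.1.Nonempty :=
  Γ.infosets.nonempty_of_mem_parts I.2

lemma actionsAt_nonempty (I : Γ.Infoset) : (Γ.actionsAt I).Nonempty := by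
  obtain ⟨h, hh⟩ := Γ.infoset_nonempty I
  rw [Γ.actionsAt_eq hh]
  have := Γ.infoset_subset I hh
  simp only [GameTree.decisionNodes, HistoryTree.nonterminals, Finset.mem_sdiff,
    Finset.mem_filter] at this
  exact Finset.nonempty_iff_ne_empty.2 this.1.2

lemma probFrom_concat (π : Γ.Infoset → A → ℝ) (h l : List A) (a : A) :
    Γ.probFrom π h (l ++ [a]) = Γ.probFrom π h l * Γ.stepProb π (h ++ l) a := by
  induction l generalizing h with
  | nil => simp [probFrom]
  | cons b l ih => simp [probFrom, ih, mul_assoc]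

lemma reachProb_nil (π : Γ.Infoset → A → ℝ) : Γ.reachProb π [] = 1 := rfl

lemma reachProb_concat (π : Γ.Infoset → A → ℝ) (h : List A) (a : A) :
    Γ.reachProb π (h ++ [a]) = Γ.reachProb π h * Γ.stepProb π h a := by
  simp [reachProb, probFrom_concat]

lemma stepProb_of_mem (π : Γ.Infoset → A → ℝ) {I : Γ.Infoset} {h : List A} (hh : h ∈ I.1)
    (a : A) : Γ.stepProb π h a = π I a := by
  have hd := Γ.infoset_subset I hh
  rw [stepProb, dif_pos hd, (Γ.infosetOf_eq_iff hd).2 hh]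

lemma stepProb_deviate_of_notMem (π : Γ.Infoset → A → ℝ) {I : Γ.Infoset} {h : List A}
    (hh : h ∉ I.1) (σ : A → ℝ) (a : A) :
    Γ.stepProb (Γ.deviate π I σ) h a = Γ.stepProb π h a := by
  unfold stepProb
  split_ifs with hd
  · rw [deviate, Function.update_of_ne]
    rwa [Ne, Γ.infosetOf_eq_iff hd]
  · rfl

variable {Γ} in
lemma IsRandomizedAction.le_one {I : Γ.Infoset} {σ : A → ℝ} (hσ : Γ.IsRandomizedAction I σ)
    (a : A) : σ a ≤ 1 := by
  by_cases ha : a ∈ Γ.actionsAt I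
  · rw [← hσ.2.2]
    exact Finset.single_le_sum (f := σ) (fun b _ => hσ.1 b) ha
  · rw [hσ.2.1 a ha]; exact zero_le_one

lemma stepProb_mem_Icc {π : Γ.Infoset → A → ℝ} (hπ : Γ.IsStrategy π) {h : List A} {a : A}
    (ha : h ++ [a] ∈ Γ.nodes) : Γ.stepProb π h a ∈ Set.Icc (0 : ℝ) 1 := by
  unfold stepProb
  split_ifs with hd
  · exact ⟨(hπ _).1 a, (hπ _).le_one a⟩
  · have hc := Γ.mem_chanceNodes ha hd
    have ha' := Γ.mem_actions.2 ha
    refine ⟨Γ.chance_nonneg h hc a ha', ?_⟩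
    rw [← Γ.chance_sum h hc]
    exact Finset.single_le_sum (f := Γ.chanceProb h) (fun b hb => Γ.chance_nonneg h hc b hb) ha'

lemma probFrom_mem_Icc {π : Γ.Infoset → A → ℝ} (hπ : Γ.IsStrategy π) (h l : List A)
    (hl : h ++ l ∈ Γ.nodes) : Γ.probFrom π h l ∈ Set.Icc (0 : ℝ) 1 := by
  induction l generalizing h with
  | nil => simp [probFrom]
  | cons a l ih =>
    have h1 : (h ++ [a]) ++ l ∈ Γ.nodes := by simpa using hl
    have h2 := Γ.stepProb_mem_Icc hπ (Γ.mem_nodes_of_prefix h1 ⟨l, rfl⟩)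
    have h3 := ih _ h1
    exact ⟨mul_nonneg h2.1 h3.1, mul_le_one₀ h2.2 h3.1 h3.2⟩

lemma reachProb_nonneg {π : Γ.Infoset → A → ℝ} (hπ : Γ.IsStrategy π) {h : List A}
    (hh : h ∈ Γ.nodes) : 0 ≤ Γ.reachProb π h := (Γ.probFrom_mem_Icc hπ [] h hh).1

lemma reachProb_le_one {π : Γ.Infoset → A → ℝ} (hπ : Γ.IsStrategy π) {h : List A}
    (hh : h ∈ Γ.nodes) : Γ.reachProb π h ≤ 1 := (Γ.probFrom_mem_Icc hπ [] h hh).2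

lemma reachProb_le_of_prefix {π : Γ.Infoset → A → ℝ} (hπ : Γ.IsStrategy π) {g h : List A}
    (hh : h ∈ Γ.nodes) (hp : g <+: h) : Γ.reachProb π h ≤ Γ.reachProb π g := by
  obtain ⟨l, rfl⟩ := hp
  induction l using List.reverseRecOn with
  | nil => simp
  | append_singleton l a ih =>
    rw [← List.append_assoc] at hh ⊢
    have hg := Γ.prefix_closed _ _ hh
    rw [reachProb_concat]
    exact (mul_le_of_le_one_right (Γ.reachProb_nonneg hπ hg) (Γ.stepProb_mem_Icc hπ hh).2).trans
      (ih hg)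

/-- A deviation at `I` does not affect the reach probability of a node without proper
ancestors in `I`. -/
lemma reachProb_deviate (π : Γ.Infoset → A → ℝ) (I : Γ.Infoset) (σ : A → ℝ) (h : List A)
    (hI : ∀ g ∈ I.1, g <+: h → g = h) :
    Γ.reachProb (Γ.deviate π I σ) h = Γ.reachProb π h := by
  induction h using List.reverseRecOn with
  | nil => rfl
  | append_singleton h a ih =>
    rw [reachProb_concat, reachProb_concat, ih, stepProb_deviate_of_notMem]
    · intro hh
      have := hI h hh ⟨[a], rfl⟩
      simp at this
    · intro g hg hp
      have := hI g hg (hp.trans ⟨[a], rfl⟩)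
      subst this
      have := hp.length_le
      simp at this

lemma continuous_stepProb (h : List A) (a : A) : Continuous fun π => Γ.stepProb π h a := by
  unfold stepProb
  split_ifs with hd
  · exact (continuous_apply a).comp (continuous_apply _)
  · exact continuous_const

lemma continuous_probFrom (h l : List A) : Continuous fun π => Γ.probFrom π h l := by
  induction l generalizing h with
  | nil => exact continuous_const
  | cons a l ih => exact (Γ.continuous_stepProb h a).mul (ih _)

lemma continuous_reachProb (h : List A) : Continuous fun π => Γ.reachProb π h :=
  Γ.continuous_probFrom [] h

lemma continuous_utility : Continuous Γ.utility :=
  continuous_finsetSum _ fun z _ => (Γ.continuous_reachProb z).mul continuous_const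

lemma continuous_deviate {X : Type*} [TopologicalSpace X] (I : Γ.Infoset)
    {p : X → Γ.Infoset → A → ℝ} {σ : X → A → ℝ} (hp : Continuous p) (hσ : Continuous σ) :
    Continuous fun x => Γ.deviate (p x) I (σ x) :=
  hp.update I hσ

/-! ### The performance difference formula -/

/-- The expected payoff from the node `e` on: the payoffs of the terminal nodes below `e`,
weighted with their probabilities when play starts at `e`. -/
noncomputable def valueFrom (π : Γ.Infoset → A → ℝ) (e : List A) : ℝ :=
  ∑ z ∈ Γ.terminals, if e <+: z then Γ.probFrom π e (z.drop e.length) * Γ.payoff z else 0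

/-- Telescoping along the path to `z`: the strategy `τ` is replaced by `π` one step at a time. -/
lemma reachProb_sub (τ π : Γ.Infoset → A → ℝ) {z : List A} (hz : z ∈ Γ.nodes) :
    Γ.reachProb τ z - Γ.reachProb π z = ∑ h ∈ Γ.nodes, ∑ a ∈ Γ.actions h,
      if h ++ [a] <+: z then Γ.reachProb τ h * (Γ.stepProb τ h a - Γ.stepProb π h a) *
        Γ.probFrom π (h ++ [a]) (z.drop (h ++ [a]).length) else 0 := by
  induction z using List.reverseRecOn with
  | nil =>
    simp [reachProb_nil]
  | append_singleton g b ih =>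
    have hg := Γ.prefix_closed _ _ hz
    have key : ∀ h ∈ Γ.nodes, ∀ a ∈ Γ.actions h,
        (if h ++ [a] <+: g ++ [b] then Γ.reachProb τ h * (Γ.stepProb τ h a - Γ.stepProb π h a) *
          Γ.probFrom π (h ++ [a]) ((g ++ [b]).drop (h ++ [a]).length) else 0) =
        (if h ++ [a] <+: g then Γ.reachProb τ h * (Γ.stepProb τ h a - Γ.stepProb π h a) *
          Γ.probFrom π (h ++ [a]) (g.drop (h ++ [a]).length) else 0) * Γ.stepProb π g b +
        (if h = g then if a = b then
          Γ.reachProb τ g * (Γ.stepProb τ g b - Γ.stepProb π g b) else 0 else 0) := by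
      intro h _ a _
      by_cases hp : h ++ [a] <+: g
      · have hne : h ≠ g := by
          rintro rfl
          have := hp.length_le
          simp at this
        rw [if_pos (hp.trans ⟨[b], rfl⟩), if_pos hp, if_neg hne, add_zero,
          List.drop_append_of_le_length hp.length_le, probFrom_concat]
        obtain ⟨l, rfl⟩ := hp
        rw [List.drop_left]
        ring
      · rw [if_neg hp, zero_mul, zero_add]
        by_cases he : h ++ [a] = g ++ [b]
        · obtain ⟨rfl, hb⟩ := List.append_inj' he rfl
          obtain rfl : a = b := by simpa using hb
          simp [probFrom]
        · rw [if_neg]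
          · split_ifs with h1 h2
            · exact absurd (by rw [h1, h2]) he
            · rfl
            · rfl
          · rw [List.prefix_concat_iff]
            exact not_or.2 ⟨he, hp⟩
    rw [Finset.sum_congr rfl fun h hh => Finset.sum_congr rfl fun a ha => key h hh a ha]
    simp only [Finset.sum_add_distrib, ← Finset.sum_mul]
    rw [← ih hg, Finset.sum_eq_single_of_mem g hg (fun h _ hne => by simp [hne])]
    rw [Finset.sum_eq_single_of_mem b (Γ.mem_actions.2 hz) (fun a _ hne => by simp [hne])]
    rw [reachProb_concat, reachProb_concat]
    simp only [if_true]
    ring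

/-- The performance difference formula: `τ` outperforms `π` by the sum, over the decision nodes
as reached under `τ`, of the gains of one step of `τ` followed by `π`. -/
theorem utility_sub (τ π : Γ.Infoset → A → ℝ) :
    Γ.utility τ - Γ.utility π = ∑ h ∈ Γ.decisionNodes, Γ.reachProb τ h *
      ∑ a ∈ Γ.actions h, (Γ.stepProb τ h a - Γ.stepProb π h a) * Γ.valueFrom π (h ++ [a]) := by
  have h1 : Γ.utility τ - Γ.utility π = ∑ h ∈ Γ.nodes, Γ.reachProb τ h *
      ∑ a ∈ Γ.actions h, (Γ.stepProb τ h a - Γ.stepProb π h a) * Γ.valueFrom π (h ++ [a]) := by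
    rw [utility, utility, ← Finset.sum_sub_distrib]
    simp only [← sub_mul]
    rw [Finset.sum_congr rfl fun z hz => by
      rw [Γ.reachProb_sub τ π (Γ.mem_nodes_of_mem_terminals hz)]]
    simp only [Finset.sum_mul, valueFrom, Finset.mul_sum]
    rw [Finset.sum_comm]
    refine Finset.sum_congr rfl fun h _ => ?_
    rw [Finset.sum_comm]
    refine Finset.sum_congr rfl fun a _ => Finset.sum_congr rfl fun z _ => ?_
    split_ifs <;> ring
  rw [h1]
  symm
  refine Finset.sum_subset (fun h hh => Γ.mem_nodes_of_mem_decisionNodes hh) fun h _ hh => ?_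
  rw [Finset.sum_eq_zero, mul_zero]
  intro a _
  rw [stepProb, stepProb, dif_neg hh, dif_neg hh, sub_self, zero_mul]

lemma sum_decisionNodes (f : List A → ℝ) :
    ∑ h ∈ Γ.decisionNodes, f h = ∑ I : Γ.Infoset, ∑ h ∈ I.1, f h := by
  rw [Finset.sum_coe_sort Γ.infosets.parts fun I => ∑ h ∈ I, f h]
  conv_lhs => rw [← Γ.infosets.biUnion_parts]
  exact Finset.sum_biUnion Γ.infosets.disjoint

/-- The gain of deviating to `σ` at `I`. The nodes of `I` are reached under the deviation,
since a path may visit `I` several times. -/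
lemma utility_deviate_sub (π : Γ.Infoset → A → ℝ) (I : Γ.Infoset) (σ : A → ℝ) :
    Γ.utility (Γ.deviate π I σ) - Γ.utility π = ∑ h ∈ I.1, Γ.reachProb (Γ.deviate π I σ) h *
      ∑ a ∈ Γ.actionsAt I, (σ a - π I a) * Γ.valueFrom π (h ++ [a]) := by
  rw [utility_sub, ← Finset.sum_subset (Γ.infoset_subset I)]
  · refine Finset.sum_congr rfl fun h hh => ?_
    rw [Γ.actionsAt_eq hh]
    simp only [Γ.stepProb_of_mem _ hh, deviate, Function.update_self]
  · intro h _ hh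
    rw [Finset.sum_eq_zero, mul_zero]
    intro a _
    rw [Γ.stepProb_deviate_of_notMem π hh, sub_self, zero_mul]

/-- The partial derivative at `(I, a)` is the sum over the nodes of `I` of reach probability
times continuation value after `a`. -/
theorem utilityDeriv_eq (π : Γ.Infoset → A → ℝ) (I : Γ.Infoset) {a : A}
    (ha : a ∈ Γ.actionsAt I) :
    Γ.utilityDeriv π I a = ∑ h ∈ I.1, Γ.reachProb π h * Γ.valueFrom π (h ++ [a]) := by
  set f : ℝ → ℝ := fun t => Γ.utility (Γ.deviate π I (Function.update (π I) a t)) with hf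
  set g : ℝ → ℝ := fun t => ∑ h ∈ I.1,
    Γ.reachProb (Γ.deviate π I (Function.update (π I) a t)) h * Γ.valueFrom π (h ++ [a]) with hg
  have hself : Γ.deviate π I (Function.update (π I) a (π I a)) = π := by simp [deviate]
  have hfg : ∀ t, f t - f (π I a) = (t - π I a) * g t := by
    intro t
    simp only [hf, hg, hself, utility_deviate_sub, Finset.mul_sum]
    refine Finset.sum_congr rfl fun h _ => ?_
    rw [Finset.sum_eq_single_of_mem a ha]
    · simp; ring
    · intro b _ hb
      simp [hb]
  have hgc : Continuous g := by
    refine continuous_finsetSum _ fun h _ => Continuous.mul ?_ continuous_const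
    exact (Γ.continuous_reachProb h).comp
      (Γ.continuous_deviate I continuous_const (continuous_const.update a continuous_id))
  have hder : HasDerivAt f (g (π I a)) (π I a) := by
    rw [hasDerivAt_iff_tendsto_slope]
    refine (hgc.tendsto _).mono_left nhdsWithin_le_nhds |>.congr' ?_
    filter_upwards [self_mem_nhdsWithin] with t ht
    rw [slope_def_field, hfg, mul_div_cancel_left₀]
    exact sub_ne_zero.2 ht
  rw [utilityDeriv, hder.deriv]
  simp only [hg, hself]

/-- The first-order gain of deviating to `σ` at `I`. -/
lemma cdtUtility_sub (π : Γ.Infoset → A → ℝ) (I : Γ.Infoset) (σ : A → ℝ) :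
    Γ.cdtUtility σ π I - Γ.utility π = ∑ h ∈ I.1, Γ.reachProb π h *
      ∑ a ∈ Γ.actionsAt I, (σ a - π I a) * Γ.valueFrom π (h ++ [a]) := by
  rw [cdtUtility, add_sub_cancel_left]
  simp only [Finset.mul_sum]
  rw [Finset.sum_comm]
  refine Finset.sum_congr rfl fun a ha => ?_
  rw [Γ.utilityDeriv_eq π I ha, Finset.mul_sum]
  exact Finset.sum_congr rfl fun h _ => by ring

/-! ### Bounds on values and gains -/

lemma valueFrom_nonneg {π : Γ.Infoset → A → ℝ} (hπ : Γ.IsStrategy π) (e : List A) :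
    0 ≤ Γ.valueFrom π e := by
  refine Finset.sum_nonneg fun z hz => ?_
  split_ifs with hp
  · refine mul_nonneg (Γ.probFrom_mem_Icc hπ _ _ ?_).1 (Γ.payoff_nonneg z hz)
    rw [List.prefix_iff_eq_append.1 hp]
    exact Γ.mem_nodes_of_mem_terminals hz
  · exact le_rfl

/-- The sum of all payoffs: a crude bound on every continuation value. -/
noncomputable def payoffSum : ℝ := ∑ z ∈ Γ.terminals, Γ.payoff z

lemma payoffSum_nonneg : 0 ≤ Γ.payoffSum := Finset.sum_nonneg Γ.payoff_nonneg

lemma valueFrom_le {π : Γ.Infoset → A → ℝ} (hπ : Γ.IsStrategy π) (e : List A) :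
    Γ.valueFrom π e ≤ Γ.payoffSum := by
  refine Finset.sum_le_sum fun z hz => ?_
  split_ifs with hp
  · refine mul_le_of_le_one_left (Γ.payoff_nonneg z hz) (Γ.probFrom_mem_Icc hπ _ _ ?_).2
    rw [List.prefix_iff_eq_append.1 hp]
    exact Γ.mem_nodes_of_mem_terminals hz
  · exact Γ.payoff_nonneg z hz

lemma utility_nonneg {π : Γ.Infoset → A → ℝ} (hπ : Γ.IsStrategy π) : 0 ≤ Γ.utility π :=
  Finset.sum_nonneg fun z hz =>
    mul_nonneg (Γ.reachProb_nonneg hπ (Γ.mem_nodes_of_mem_terminals hz)) (Γ.payoff_nonneg z hz)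

lemma mem_nodes_of_mem_infoset {I : Γ.Infoset} {h : List A} (hh : h ∈ I.1) : h ∈ Γ.nodes :=
  Γ.mem_nodes_of_mem_decisionNodes (Γ.infoset_subset I hh)

lemma firstNodes_subset (I : Γ.Infoset) : Γ.firstNodes I ⊆ I.1 := Finset.filter_subset _ _

lemma infosetProb_nonneg {π : Γ.Infoset → A → ℝ} (hπ : Γ.IsStrategy π) (I : Γ.Infoset) :
    0 ≤ Γ.infosetProb π I :=
  Finset.sum_nonneg fun _ hh =>
    Γ.reachProb_nonneg hπ (Γ.mem_nodes_of_mem_infoset (Γ.firstNodes_subset I hh))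

lemma frequency_nonneg {π : Γ.Infoset → A → ℝ} (hπ : Γ.IsStrategy π) (I : Γ.Infoset) :
    0 ≤ Γ.frequency π I :=
  Finset.sum_nonneg fun _ hh => Γ.reachProb_nonneg hπ (Γ.mem_nodes_of_mem_infoset hh)

lemma frequency_le_card {π : Γ.Infoset → A → ℝ} (hπ : Γ.IsStrategy π) (I : Γ.Infoset) :
    Γ.frequency π I ≤ (I.1.card : ℝ) := by
  refine (Finset.sum_le_sum fun h hh =>
    Γ.reachProb_le_one hπ (Γ.mem_nodes_of_mem_infoset hh)).trans ?_
  simp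

lemma infosetProb_le_frequency {π : Γ.Infoset → A → ℝ} (hπ : Γ.IsStrategy π) (I : Γ.Infoset) :
    Γ.infosetProb π I ≤ Γ.frequency π I :=
  Finset.sum_le_sum_of_subset_of_nonneg (Γ.firstNodes_subset I) fun _ hh _ =>
    Γ.reachProb_nonneg hπ (Γ.mem_nodes_of_mem_infoset hh)

/-- Every node of an infoset has an ancestor at which the infoset is entered for the first
time. -/
lemma exists_mem_firstNodes {I : Γ.Infoset} {h : List A} (hh : h ∈ I.1) :
    ∃ f ∈ Γ.firstNodes I, f <+: h := by
  obtain ⟨f, hf, hmin⟩ := Finset.exists_min_image (I.1.filter (· <+: h)) List.length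
    ⟨h, Finset.mem_filter.2 ⟨hh, List.prefix_rfl⟩⟩
  rw [Finset.mem_filter] at hf
  refine ⟨f, Finset.mem_filter.2 ⟨hf.1, fun g hg hp => ?_⟩, hf.2⟩
  exact hp.eq_of_length_le (hmin g (Finset.mem_filter.2 ⟨hg, hp.trans hf.2⟩))

lemma isStrategy_deviate {π : Γ.Infoset → A → ℝ} (hπ : Γ.IsStrategy π) {I : Γ.Infoset}
    {σ : A → ℝ} (hσ : Γ.IsRandomizedAction I σ) : Γ.IsStrategy (Γ.deviate π I σ) := by
  intro J
  by_cases h : J = I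
  · subst h; simpa [deviate] using hσ
  · rw [deviate, Function.update_of_ne h]; exact hπ J

/-- A deviation at `I` does not change the probability of entering `I`, so that it can raise the
visit frequency of `I` only by the bounded number of repeated visits. -/
lemma frequency_deviate_le {π : Γ.Infoset → A → ℝ} (hπ : Γ.IsStrategy π) {I : Γ.Infoset}
    {σ : A → ℝ} (hσ : Γ.IsRandomizedAction I σ) :
    Γ.frequency (Γ.deviate π I σ) I ≤ I.1.card * Γ.infosetProb π I := by
  rw [← nsmul_eq_mul]
  refine Finset.sum_le_card_nsmul _ _ _ fun h hh => ?_
  obtain ⟨f, hf, hp⟩ := Γ.exists_mem_firstNodes hh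
  have hd := Γ.isStrategy_deviate hπ hσ
  refine (Γ.reachProb_le_of_prefix hd (Γ.mem_nodes_of_mem_infoset hh) hp).trans ?_
  rw [Γ.reachProb_deviate π I σ f (Finset.mem_filter.1 hf).2]
  exact Finset.single_le_sum (f := Γ.reachProb π) (fun g hg =>
    Γ.reachProb_nonneg hπ (Γ.mem_nodes_of_mem_infoset (Γ.firstNodes_subset I hg))) hf

/-- If `I` is not entered, no deviation at `I` matters. -/
lemma utility_deviate_eq {π : Γ.Infoset → A → ℝ} (hπ : Γ.IsStrategy π) {I : Γ.Infoset}
    (h0 : Γ.infosetProb π I = 0) {σ : A → ℝ} (hσ : Γ.IsRandomizedAction I σ) :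
    Γ.utility (Γ.deviate π I σ) = Γ.utility π := by
  have hd := Γ.isStrategy_deviate hπ hσ
  have hle := Γ.frequency_deviate_le hπ hσ
  rw [h0, mul_zero] at hle
  have hz := (Finset.sum_eq_zero_iff_of_nonneg fun h hh =>
    Γ.reachProb_nonneg hd (Γ.mem_nodes_of_mem_infoset hh)).1
    (hle.antisymm (Γ.frequency_nonneg hd I))
  rw [← sub_eq_zero, utility_deviate_sub]
  exact Finset.sum_eq_zero fun h hh => by rw [hz h hh, zero_mul]

lemma cdtUtility_eq {π : Γ.Infoset → A → ℝ} (hπ : Γ.IsStrategy π) {I : Γ.Infoset}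
    (h0 : Γ.frequency π I = 0) (σ : A → ℝ) : Γ.cdtUtility σ π I = Γ.utility π := by
  have hz := (Finset.sum_eq_zero_iff_of_nonneg fun h hh =>
    Γ.reachProb_nonneg hπ (Γ.mem_nodes_of_mem_infoset hh)).1 h0
  rw [← sub_eq_zero, cdtUtility_sub]
  exact Finset.sum_eq_zero fun h hh => by rw [hz h hh, zero_mul]

/-! ### Approximate rationality -/

/-- The gain of every EDT deviation, conditional on entering the infoset, is at most `ε`. -/
def IsApproxEDT (ε : ℝ) (π : Γ.Infoset → A → ℝ) : Prop :=
  ∀ I, 0 < Γ.infosetProb π I → ∀ σ, Γ.IsRandomizedAction I σ →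
    1 / Γ.infosetProb π I * (Γ.utility (Γ.deviate π I σ) - Γ.utility π) ≤ ε

/-- The gain of every CDT deviation, relative to the visit frequency of the infoset, is at
most `ε`. -/
def IsApproxCDT (ε : ℝ) (π : Γ.Infoset → A → ℝ) : Prop :=
  ∀ I, 0 < Γ.frequency π I → ∀ σ, Γ.IsRandomizedAction I σ →
    1 / Γ.frequency π I * (Γ.cdtUtility σ π I - Γ.utility π) ≤ ε

variable {Γ} in
lemma IsApproxEDT.mono {ε ε' : ℝ} (h : ε ≤ ε') {π : Γ.Infoset → A → ℝ}
    (hπ : Γ.IsApproxEDT ε π) : Γ.IsApproxEDT ε' π :=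
  fun I hI σ hσ => (hπ I hI σ hσ).trans h

variable {Γ} in
lemma IsApproxCDT.mono {ε ε' : ℝ} (h : ε ≤ ε') {π : Γ.Infoset → A → ℝ}
    (hπ : Γ.IsApproxCDT ε π) : Γ.IsApproxCDT ε' π :=
  fun I hI σ hσ => (hπ I hI σ hσ).trans h

variable {Γ} in
lemma IsApproxEDT.gain_le {ε : ℝ} {π : Γ.Infoset → A → ℝ} (hπ : Γ.IsStrategy π)
    (h : Γ.IsApproxEDT ε π) {I : Γ.Infoset} {σ : A → ℝ} (hσ : Γ.IsRandomizedAction I σ) :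
    Γ.utility (Γ.deviate π I σ) - Γ.utility π ≤ ε * Γ.infosetProb π I := by
  rcases (Γ.infosetProb_nonneg hπ I).eq_or_lt with h0 | h0
  · rw [Γ.utility_deviate_eq hπ h0.symm hσ, ← h0]; simp
  · have := h I h0 σ hσ
    rwa [one_div, inv_mul_le_iff₀ h0, mul_comm] at this

variable {Γ} in
lemma IsApproxCDT.gain_le {ε : ℝ} {π : Γ.Infoset → A → ℝ} (hπ : Γ.IsStrategy π)
    (h : Γ.IsApproxCDT ε π) {I : Γ.Infoset} {σ : A → ℝ} (hσ : Γ.IsRandomizedAction I σ) :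
    Γ.cdtUtility σ π I - Γ.utility π ≤ ε * Γ.frequency π I := by
  rcases (Γ.frequency_nonneg hπ I).eq_or_lt with h0 | h0
  · rw [Γ.cdtUtility_eq hπ h0.symm σ, ← h0]; simp
  · have := h I h0 σ hσ
    rwa [one_div, inv_mul_le_iff₀ h0, mul_comm] at this

/-! ### Strategies form a compact set -/

lemma isClosed_setOf_isRandomizedAction (I : Γ.Infoset) :
    IsClosed {σ : A → ℝ | Γ.IsRandomizedAction I σ} := by
  simp only [IsRandomizedAction, Set.ofPred_and, Set.ofPred_forall]
  refine (isClosed_iInter fun a => isClosed_le continuous_const (continuous_apply a)).inter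
    ((isClosed_iInter fun a => isClosed_iInter fun _ =>
      isClosed_eq (continuous_apply a) continuous_const).inter
    (isClosed_eq (continuous_finsetSum _ fun a _ => continuous_apply a) continuous_const))

lemma isCompact_setOf_isStrategy : IsCompact {π | Γ.IsStrategy π} := by
  have hK : IsCompact (Set.univ.pi fun _ : Γ.Infoset =>
      Set.univ.pi fun _ : A => Set.Icc (0 : ℝ) 1) :=
    isCompact_univ_pi fun _ => isCompact_univ_pi fun _ => isCompact_Icc
  refine hK.of_isClosed_subset ?_ fun π hπ I _ a _ => ⟨(hπ I).1 a, (hπ I).le_one a⟩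
  simp only [IsStrategy, Set.ofPred_forall]
  exact isClosed_iInter fun I =>
    (Γ.isClosed_setOf_isRandomizedAction I).preimage
      (f := fun π : Γ.Infoset → A → ℝ => π I) (by fun_prop)

/-- The uniform strategy. -/
noncomputable def uniform (I : Γ.Infoset) (a : A) : ℝ :=
  if a ∈ Γ.actionsAt I then ((Γ.actionsAt I).card : ℝ)⁻¹ else 0

lemma uniform_pos {I : Γ.Infoset} {a : A} (ha : a ∈ Γ.actionsAt I) : 0 < Γ.uniform I a := by
  rw [uniform, if_pos ha, inv_pos]
  exact_mod_cast (Γ.actionsAt_nonempty I).card_pos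

lemma isStrategy_uniform : Γ.IsStrategy Γ.uniform := by
  intro I
  refine ⟨fun a => ?_, fun a ha => if_neg ha, ?_⟩
  · unfold uniform; split_ifs <;> positivity
  · unfold uniform
    rw [Finset.sum_congr rfl fun a ha => if_pos ha, Finset.sum_const, nsmul_eq_mul,
      mul_inv_cancel₀]
    exact_mod_cast (Γ.actionsAt_nonempty I).card_pos.ne'

/-- The mixture `(1 - δ) σ + δ ρ`. -/
def mix (δ : ℝ) (σ ρ : A → ℝ) (a : A) : ℝ := (1 - δ) * σ a + δ * ρ a

variable {Γ} in
lemma IsRandomizedAction.mix {I : Γ.Infoset} {σ ρ : A → ℝ} (hσ : Γ.IsRandomizedAction I σ)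
    (hρ : Γ.IsRandomizedAction I ρ) {δ : ℝ} (h0 : 0 ≤ δ) (h1 : δ ≤ 1) :
    Γ.IsRandomizedAction I (mix δ σ ρ) := by
  refine ⟨fun a => ?_, fun a ha => ?_, ?_⟩
  · exact add_nonneg (mul_nonneg (sub_nonneg.2 h1) (hσ.1 a)) (mul_nonneg h0 (hρ.1 a))
  · simp [SinglePlayerGame.mix, hσ.2.1 a ha, hρ.2.1 a ha]
  · simp only [SinglePlayerGame.mix]
    rw [Finset.sum_add_distrib, ← Finset.mul_sum, ← Finset.mul_sum, hσ.2.2, hρ.2.2]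
    ring

/-- `π` plays every available action with positive probability. -/
def IsFullyMixed (π : Γ.Infoset → A → ℝ) : Prop := ∀ I, ∀ a ∈ Γ.actionsAt I, 0 < π I a

/-! ### Existence of approximately rational strategies -/

/-- The utility attains a maximum on the strategies that tremble uniformly with
probability `δ`. -/
lemma exists_max_mix (δ : ℝ) : ∃ τ, Γ.IsStrategy τ ∧ ∀ τ', Γ.IsStrategy τ' →
    Γ.utility (fun I => mix δ (τ' I) (Γ.uniform I)) ≤
      Γ.utility (fun I => mix δ (τ I) (Γ.uniform I)) := by
  have hc : Continuous fun τ : Γ.Infoset → A → ℝ =>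
      Γ.utility (fun I => mix δ (τ I) (Γ.uniform I)) := by
    refine Γ.continuous_utility.comp (continuous_pi fun I => continuous_pi fun a => ?_)
    unfold mix; fun_prop
  obtain ⟨τ, hτ, hmax⟩ := Γ.isCompact_setOf_isStrategy.exists_isMaxOn
    ⟨_, Γ.isStrategy_uniform⟩ hc.continuousOn
  exact ⟨τ, hτ, fun τ' h' => hmax h'⟩

/-- Trembling costs little: if `σ` is replaced by its mixture with the uniform action, the expected
continuation value drops by at most `δ` times the sum of payoffs. -/
lemma sum_mul_valueFrom_le {π : Γ.Infoset → A → ℝ} (hπ : Γ.IsStrategy π) {I : Γ.Infoset}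
    {σ : A → ℝ} (hσ : Γ.IsRandomizedAction I σ) {δ : ℝ} (h0 : 0 ≤ δ) (h : List A) :
    ∑ a ∈ Γ.actionsAt I, (σ a - mix δ σ (Γ.uniform I) a) * Γ.valueFrom π (h ++ [a]) ≤
      δ * Γ.payoffSum := by
  calc ∑ a ∈ Γ.actionsAt I, (σ a - mix δ σ (Γ.uniform I) a) * Γ.valueFrom π (h ++ [a])
      ≤ ∑ a ∈ Γ.actionsAt I, σ a * (δ * Γ.payoffSum) := by
        refine Finset.sum_le_sum fun a ha => ?_
        have h1 : (σ a - mix δ σ (Γ.uniform I) a) * Γ.valueFrom π (h ++ [a]) =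
            σ a * (δ * Γ.valueFrom π (h ++ [a])) -
              δ * (Γ.uniform I a * Γ.valueFrom π (h ++ [a])) := by
          unfold mix; ring
        rw [h1]
        have h2 : 0 ≤ δ * (Γ.uniform I a * Γ.valueFrom π (h ++ [a])) :=
          mul_nonneg h0 (mul_nonneg (Γ.uniform_pos ha).le (Γ.valueFrom_nonneg hπ _))
        have h3 : σ a * (δ * Γ.valueFrom π (h ++ [a])) ≤ σ a * (δ * Γ.payoffSum) :=
          mul_le_mul_of_nonneg_left
            (mul_le_mul_of_nonneg_left (Γ.valueFrom_le hπ _) h0) (hσ.1 a)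
        linarith
    _ = δ * Γ.payoffSum := by rw [← Finset.sum_mul, hσ.2.2, one_mul]

/-- A maximizer over the uniformly trembling strategies is a fully mixed strategy whose gains
from deviating, in the EDT and in the CDT sense, are of the order of the tremble. -/
theorem exists_isApproxEDT_isApproxCDT {ε : ℝ} (hε : 0 < ε) :
    ∃ π, Γ.IsStrategy π ∧ Γ.IsFullyMixed π ∧ Γ.IsApproxEDT ε π ∧ Γ.IsApproxCDT ε π := by
  set C : ℝ := (Γ.nodes.card + 1) * (Γ.payoffSum + 1) with hC
  have hP := Γ.payoffSum_nonneg
  have hCpos : 0 < C := by positivity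
  set δ : ℝ := min 1 (ε / C) with hδ
  have hδ0 : 0 < δ := lt_min one_pos (div_pos hε hCpos)
  have hδ1 : δ ≤ 1 := min_le_left _ _
  have hδC : δ * C ≤ ε := (le_div_iff₀ hCpos).1 (min_le_right _ _)
  have hN : (0 : ℝ) ≤ Γ.nodes.card := Nat.cast_nonneg _
  have hbound : ∀ I : Γ.Infoset, I.1.card * (δ * Γ.payoffSum) ≤ ε := by
    intro I
    have h1 : (I.1.card : ℝ) ≤ Γ.nodes.card := by
      exact_mod_cast Finset.card_le_card fun h hh => Γ.mem_nodes_of_mem_infoset hh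
    calc I.1.card * (δ * Γ.payoffSum) ≤ Γ.nodes.card * (δ * Γ.payoffSum) :=
          mul_le_mul_of_nonneg_right h1 (by positivity)
      _ = δ * (Γ.nodes.card * Γ.payoffSum) := by ring
      _ ≤ δ * C := mul_le_mul_of_nonneg_left (by rw [hC]; nlinarith) hδ0.le
      _ ≤ ε := hδC
  have hbound' : δ * Γ.payoffSum ≤ ε := by
    refine le_trans (mul_le_mul_of_nonneg_left ?_ hδ0.le) hδC
    rw [hC]; nlinarith [mul_nonneg hN hP]
  obtain ⟨τ, hτ, hmax⟩ := Γ.exists_max_mix δ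
  set π : Γ.Infoset → A → ℝ := fun I => mix δ (τ I) (Γ.uniform I) with hπdef
  have hπ : Γ.IsStrategy π := fun I => (hτ I).mix (Γ.isStrategy_uniform I) hδ0.le hδ1
  -- deviations that respect the tremble do not improve on the maximizer
  have hdev : ∀ I σ, Γ.IsRandomizedAction I σ →
      Γ.utility (Γ.deviate π I (mix δ σ (Γ.uniform I))) ≤ Γ.utility π := by
    intro I σ hσ
    have h1 : Γ.deviate π I (mix δ σ (Γ.uniform I)) =
        fun J => mix δ (Γ.deviate τ I σ J) (Γ.uniform J) := by
      funext J
      by_cases h : J = I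
      · subst h; simp [deviate]
      · simp [deviate, Function.update_of_ne h, hπdef]
    rw [h1]
    exact hmax _ (Γ.isStrategy_deviate hτ hσ)
  refine ⟨π, hπ, fun I a ha => ?_, fun I hI σ hσ => ?_, fun I hI σ hσ => ?_⟩
  · exact add_pos_of_nonneg_of_pos (mul_nonneg (sub_nonneg.2 hδ1) ((hτ I).1 a))
      (mul_pos hδ0 (Γ.uniform_pos ha))
  · rw [one_div, inv_mul_le_iff₀ hI]
    set ρ := mix δ σ (Γ.uniform I) with hρdef
    have hρ : Γ.IsRandomizedAction I ρ := hσ.mix (Γ.isStrategy_uniform I) hδ0.le hδ1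
    have h1 := hdev I σ hσ
    have h2 : Γ.utility (Γ.deviate π I σ) - Γ.utility (Γ.deviate π I ρ) ≤
        Γ.frequency (Γ.deviate π I σ) I * (δ * Γ.payoffSum) := by
      have h3 : Γ.deviate π I σ = Γ.deviate (Γ.deviate π I ρ) I σ := by simp [deviate]
      conv_lhs => rw [h3]
      rw [utility_deviate_sub, ← h3, frequency, Finset.sum_mul]
      refine Finset.sum_le_sum fun h hh => mul_le_mul_of_nonneg_left ?_
        (Γ.reachProb_nonneg (Γ.isStrategy_deviate hπ hσ) (Γ.mem_nodes_of_mem_infoset hh))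
      have h4 : Γ.deviate π I ρ I = ρ := by simp [deviate]
      rw [h4]
      exact Γ.sum_mul_valueFrom_le (Γ.isStrategy_deviate hπ hρ) hσ hδ0.le h
    have h5 := mul_le_mul_of_nonneg_right (Γ.frequency_deviate_le hπ hσ)
      (mul_nonneg hδ0.le hP)
    have h6 := mul_le_mul_of_nonneg_left (hbound I) hI.le
    linarith
  · rw [one_div, inv_mul_le_iff₀ hI]
    set ρ := mix δ σ (Γ.uniform I) with hρdef
    -- the gain of moving a fraction `s` of the way to `ρ` is `s * g s`
    set g : ℝ → ℝ := fun s => ∑ h ∈ I.1, Γ.reachProb (Γ.deviate π I (mix s (π I) ρ)) h *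
      ∑ a ∈ Γ.actionsAt I, (ρ a - π I a) * Γ.valueFrom π (h ++ [a]) with hg
    have hgc : Continuous g := by
      refine continuous_finsetSum _ fun h _ => Continuous.mul ?_ continuous_const
      refine (Γ.continuous_reachProb h).comp
        (Γ.continuous_deviate I continuous_const (continuous_pi fun a => ?_))
      unfold mix; fun_prop
    have hgle : ∀ s ∈ Set.Ioc (0 : ℝ) 1, g s ≤ 0 := by
      intro s hs
      have h1 : mix s (π I) ρ = mix δ (mix s (τ I) σ) (Γ.uniform I) := by
        funext a; simp only [hπdef, hρdef, mix]; ring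
      have h2 := hdev I (mix s (τ I) σ) ((hτ I).mix hσ hs.1.le hs.2)
      rw [← h1, ← sub_nonpos, utility_deviate_sub] at h2
      have h3 : ∀ h : List A, ∑ a ∈ Γ.actionsAt I,
          (mix s (π I) ρ a - π I a) * Γ.valueFrom π (h ++ [a]) =
          s * ∑ a ∈ Γ.actionsAt I, (ρ a - π I a) * Γ.valueFrom π (h ++ [a]) := by
        intro h
        rw [Finset.mul_sum]
        refine Finset.sum_congr rfl fun a _ => ?_
        unfold mix; ring
      simp only [h3, mul_left_comm _ s, ← Finset.mul_sum] at h2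
      exact nonpos_of_mul_nonpos_right h2 hs.1
    have hg0 : g 0 ≤ 0 := by
      refine le_of_tendsto (hgc.continuousWithinAt (s := Set.Ioi 0) (x := 0)).tendsto ?_
      filter_upwards [Ioc_mem_nhdsGT (zero_lt_one (α := ℝ))] with s hs using hgle s hs
    have hg0' : g 0 = ∑ h ∈ I.1, Γ.reachProb π h *
        ∑ a ∈ Γ.actionsAt I, (ρ a - π I a) * Γ.valueFrom π (h ++ [a]) := by
      have : mix 0 (π I) ρ = π I := by funext a; simp [mix]
      simp [hg, this, deviate]
    have h7 : Γ.cdtUtility σ π I - Γ.utility π - g 0 ≤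
        Γ.frequency π I * (δ * Γ.payoffSum) := by
      rw [cdtUtility_sub, hg0', ← Finset.sum_sub_distrib, frequency, Finset.sum_mul]
      refine Finset.sum_le_sum fun h hh => ?_
      rw [← mul_sub, ← Finset.sum_sub_distrib]
      simp only [← sub_mul, sub_sub_sub_cancel_right]
      exact mul_le_mul_of_nonneg_left (Γ.sum_mul_valueFrom_le hπ hσ hδ0.le h)
        (Γ.reachProb_nonneg hπ (Γ.mem_nodes_of_mem_infoset hh))
    have h8 := mul_le_mul_of_nonneg_left hbound' hI.le
    linarith

/-! ### Limits of approximately rational strategies -/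

/-- `π` is a limit of fully mixed strategies that satisfy the condition `C ε` for `ε` tending
to `0`. EDT and CDT rationality are the cases of `IsApproxEDT` and `IsApproxCDT`. -/
def IsTrembleLimit (C : ℝ → (Γ.Infoset → A → ℝ) → Prop) (π : Γ.Infoset → A → ℝ) : Prop :=
  Γ.IsStrategy π ∧ ∃ p ε, Γ.IsTrembleSequence π p ε ∧ ∀ k, C (ε k) (p k)

/-- The fully mixed strategies that satisfy the condition `C`. -/
def fullyMixedSet (C : (Γ.Infoset → A → ℝ) → Prop) : Set (Γ.Infoset → A → ℝ) :=
  {p | Γ.IsStrategy p ∧ Γ.IsFullyMixed p ∧ C p}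

variable {Γ} in
/-- Tremble limits are described by closures. Sequences suffice although the set of actions may
be uncountable, because strategies vanish at all but finitely many coordinates. -/
lemma isTrembleLimit_iff {C : ℝ → (Γ.Infoset → A → ℝ) → Prop}
    (hC : ∀ ε ε' π, ε ≤ ε' → C ε π → C ε' π) (π : Γ.Infoset → A → ℝ) :
    Γ.IsTrembleLimit C π ↔ Γ.IsStrategy π ∧
      ∀ n : ℕ, π ∈ closure (Γ.fullyMixedSet (C (1 / ((n : ℝ) + 1)))) := by
  refine and_congr_right fun hπ => ⟨?_, fun h => ?_⟩
  · rintro ⟨p, ε, ⟨hp, hmix, hlim, -, hε⟩, hCp⟩ n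
    refine mem_closure_of_tendsto (f := p) (b := atTop)
      (tendsto_pi_nhds.2 fun I => tendsto_pi_nhds.2 fun a => hlim I a) ?_
    filter_upwards [hε.eventually_lt_const (Nat.one_div_pos_of_nat (α := ℝ) (n := n))] with k hk
    exact ⟨hp k, hmix k, hC _ _ _ hk.le (hCp k)⟩
  · have hex : ∀ n : ℕ, ∃ p ∈ Γ.fullyMixedSet (C (1 / ((n : ℝ) + 1))),
        ∀ I, ∀ a ∈ Γ.actionsAt I, |p I a - π I a| < 1 / ((n : ℝ) + 1) := by
      intro n
      have hnhds : {p : Γ.Infoset → A → ℝ | ∀ I, ∀ a ∈ Γ.actionsAt I,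
          |p I a - π I a| < 1 / ((n : ℝ) + 1)} ∈ 𝓝 π := by
        refine Filter.eventually_all.2 fun I =>
          (Filter.eventually_all_finset (Γ.actionsAt I)).2 fun a _ => ?_
        have hc : Continuous fun p : Γ.Infoset → A → ℝ => |p I a - π I a| := by fun_prop
        refine hc.continuousAt.eventually_lt_const ?_
        simp only [sub_self, abs_zero]
        exact Nat.one_div_pos_of_nat
      obtain ⟨p, hp, hp'⟩ := mem_closure_iff_nhds.1 (h n) _ hnhds
      exact ⟨p, hp', hp⟩
    choose p hp hclose using hex
    refine ⟨p, fun n => 1 / ((n : ℝ) + 1), ⟨fun k => (hp k).1, fun k => (hp k).2.1, fun I a => ?_,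
      fun k => Nat.one_div_pos_of_nat, tendsto_one_div_add_atTop_nhds_zero_nat⟩,
      fun k => (hp k).2.2⟩
    by_cases ha : a ∈ Γ.actionsAt I
    · rw [tendsto_iff_dist_tendsto_zero]
      refine squeeze_zero (fun _ => dist_nonneg) (fun k => ?_)
        (tendsto_one_div_add_atTop_nhds_zero_nat (𝕜 := ℝ))
      rw [Real.dist_eq]
      exact (hclose k I a ha).le
    · simp only [(hπ I).2.1 a ha, ((hp _).1 I).2.1 a ha]
      exact tendsto_const_nhds

lemma isCompact_setOf_isTrembleLimit {C : ℝ → (Γ.Infoset → A → ℝ) → Prop}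
    (hC : ∀ ε ε' π, ε ≤ ε' → C ε π → C ε' π) : IsCompact {π | Γ.IsTrembleLimit C π} := by
  simp only [isTrembleLimit_iff hC, Set.ofPred_and, Set.ofPred_forall]
  exact Γ.isCompact_setOf_isStrategy.inter_right (isClosed_iInter fun n => isClosed_closure)

lemma exists_isTrembleLimit {C : ℝ → (Γ.Infoset → A → ℝ) → Prop}
    (hC : ∀ ε ε' π, ε ≤ ε' → C ε π → C ε' π)
    (hex : ∀ ε, 0 < ε → (Γ.fullyMixedSet (C ε)).Nonempty) : ∃ π, Γ.IsTrembleLimit C π := by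
  have hclosed := Γ.isCompact_setOf_isStrategy.isClosed
  have hsub : ∀ n : ℕ, closure (Γ.fullyMixedSet (C (1 / ((n : ℝ) + 1)))) ⊆
      {π | Γ.IsStrategy π} := fun n => closure_minimal (fun p hp => hp.1) hclosed
  obtain ⟨π, hπ⟩ := IsCompact.nonempty_iInter_of_sequence_nonempty_isCompact_isClosed
    (fun n : ℕ => closure (Γ.fullyMixedSet (C (1 / ((n : ℝ) + 1)))))
    (fun n => closure_mono fun p hp => ⟨hp.1, hp.2.1, hC _ _ _
      (one_div_le_one_div_of_le (by positivity) (by push_cast; linarith)) hp.2.2⟩)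
    (fun n => (hex _ Nat.one_div_pos_of_nat).closure)
    (Γ.isCompact_setOf_isStrategy.of_isClosed_subset isClosed_closure (hsub 0))
    (fun n => isClosed_closure)
  rw [Set.mem_iInter] at hπ
  exact ⟨π, (isTrembleLimit_iff hC π).2 ⟨hsub 0 (hπ 0), hπ⟩⟩

/-! ### Equilibria -/

lemma isClosed_setOf_isEDTEquilibrium : IsClosed {π | Γ.IsEDTEquilibrium π} := by
  simp only [IsEDTEquilibrium, Set.ofPred_and, Set.ofPred_forall]
  refine Γ.isCompact_setOf_isStrategy.isClosed.inter
    (isClosed_iInter fun I => isClosed_iInter fun σ => isClosed_iInter fun _ => ?_)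
  exact isClosed_le (Γ.continuous_utility.comp
    (Γ.continuous_deviate I continuous_id continuous_const)) Γ.continuous_utility

lemma continuous_cdtUtility (I : Γ.Infoset) (σ : A → ℝ) :
    Continuous fun π => Γ.cdtUtility σ π I := by
  refine Γ.continuous_utility.add (continuous_finsetSum _ fun a ha => ?_)
  simp only [Γ.utilityDeriv_eq _ I ha]
  refine Continuous.mul (by fun_prop) (continuous_finsetSum _ fun h _ =>
    (Γ.continuous_reachProb h).mul (continuous_finsetSum _ fun z _ => ?_))
  split_ifs
  · exact (Γ.continuous_probFrom _ _).mul continuous_const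
  · exact continuous_const

/-- The KKT conditions over a product of simplices say that no deviation at a single infoset has
a positive first-order gain. -/
lemma isCDTEquilibrium_iff (π : Γ.Infoset → A → ℝ) :
    Γ.IsCDTEquilibrium π ↔ Γ.IsStrategy π ∧ ∀ I σ, Γ.IsRandomizedAction I σ →
      Γ.cdtUtility σ π I ≤ Γ.utility π := by
  refine and_congr_right fun hπ => ⟨?_, fun h => ?_⟩
  · rintro ⟨lam, μ, h⟩ I σ hσ
    have h1 : ∑ a ∈ Γ.actionsAt I, (σ a - π I a) * Γ.utilityDeriv π I a ≤
        ∑ a ∈ Γ.actionsAt I, (σ a - π I a) * lam I := by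
      refine Finset.sum_le_sum fun a ha => ?_
      obtain ⟨h0, hc, he⟩ := h I a ha
      have h2 : Γ.utilityDeriv π I a = lam I - μ I a := by linarith
      rw [h2]
      nlinarith [mul_nonneg (hσ.1 a) h0]
    rw [← Finset.sum_mul, Finset.sum_sub_distrib, hσ.2.2, (hπ I).2.2, sub_self, zero_mul] at h1
    rw [cdtUtility]
    linarith
  · set lam : Γ.Infoset → ℝ := fun I => ∑ b ∈ Γ.actionsAt I, π I b * Γ.utilityDeriv π I b
      with hlam
    have hle : ∀ I, ∀ a ∈ Γ.actionsAt I, Γ.utilityDeriv π I a ≤ lam I := by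
      intro I a ha
      have hσ : Γ.IsRandomizedAction I (Pi.single a 1) := by
        refine ⟨fun b => ?_, fun b hb => ?_, ?_⟩
        · by_cases hb : b = a
          · subst hb; simp
          · simp [hb]
        · rw [Pi.single_eq_of_ne]
          rintro rfl
          exact hb ha
        · rw [Finset.sum_eq_single_of_mem a ha (fun b _ hb => by simp [hb]), Pi.single_eq_same]
      have h1 := h I _ hσ
      simp only [cdtUtility, sub_mul, Finset.sum_sub_distrib] at h1
      rw [Finset.sum_eq_single_of_mem a ha (fun b _ hb => by simp [hb]), Pi.single_eq_same,
        one_mul] at h1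
      simp only [hlam]
      linarith
    refine ⟨lam, fun I a => lam I - Γ.utilityDeriv π I a, fun I a ha =>
      ⟨sub_nonneg.2 (hle I a ha), ?_, by ring⟩⟩
    -- the nonnegative complementarity products sum to zero
    have hsum : ∑ b ∈ Γ.actionsAt I, (lam I - Γ.utilityDeriv π I b) * π I b = 0 := by
      simp only [sub_mul, Finset.sum_sub_distrib, ← Finset.mul_sum, (hπ I).2.2, mul_one]
      simp only [hlam, mul_comm, sub_self]
    exact (Finset.sum_eq_zero_iff_of_nonneg fun b hb =>
      mul_nonneg (sub_nonneg.2 (hle I b hb)) ((hπ I).1 b)).1 hsum a ha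

lemma isClosed_setOf_isCDTEquilibrium : IsClosed {π | Γ.IsCDTEquilibrium π} := by
  simp only [isCDTEquilibrium_iff, Set.ofPred_and, Set.ofPred_forall]
  exact Γ.isCompact_setOf_isStrategy.isClosed.inter
    (isClosed_iInter fun I => isClosed_iInter fun σ => isClosed_iInter fun _ =>
      isClosed_le (Γ.continuous_cdtUtility I σ) Γ.continuous_utility)

variable {Γ} in
lemma IsTrembleSequence.tendsto {π : Γ.Infoset → A → ℝ} {p : ℕ → Γ.Infoset → A → ℝ} {ε : ℕ → ℝ}
    (h : Γ.IsTrembleSequence π p ε) : Tendsto p atTop (𝓝 π) :=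
  tendsto_pi_nhds.2 fun I => tendsto_pi_nhds.2 fun a => h.2.2.1 I a

variable {Γ} in
lemma IsEDTRational.isEDTEquilibrium {π : Γ.Infoset → A → ℝ} (h : Γ.IsEDTRational π) :
    Γ.IsEDTEquilibrium π := by
  obtain ⟨hπ, p, ε, ht, hC⟩ := h
  refine ⟨hπ, fun I σ hσ => ?_⟩
  have h1 : ∀ k, Γ.utility (Γ.deviate (p k) I σ) ≤ Γ.utility (p k) + ε k * I.1.card := by
    intro k
    have h2 := IsApproxEDT.gain_le (ht.1 k) (hC k) hσ
    have h3 := mul_le_mul_of_nonneg_left ((Γ.infosetProb_le_frequency (ht.1 k) I).trans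
      (Γ.frequency_le_card (ht.1 k) I)) (ht.2.2.2.1 k).le
    linarith
  have hlim := ht.tendsto
  have h4 := ((Γ.continuous_utility.tendsto π).comp hlim).add
    (ht.2.2.2.2.mul_const (I.1.card : ℝ))
  rw [zero_mul, add_zero] at h4
  exact le_of_tendsto_of_tendsto' (((Γ.continuous_utility.comp
    (Γ.continuous_deviate I continuous_id continuous_const)).tendsto π).comp hlim) h4 h1

variable {Γ} in
lemma IsCDTRational.isCDTEquilibrium {π : Γ.Infoset → A → ℝ} (h : Γ.IsCDTRational π) :
    Γ.IsCDTEquilibrium π := by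
  obtain ⟨hπ, p, ε, ht, hC⟩ := h
  refine (Γ.isCDTEquilibrium_iff π).2 ⟨hπ, fun I σ hσ => ?_⟩
  have h1 : ∀ k, Γ.cdtUtility σ (p k) I ≤ Γ.utility (p k) + ε k * I.1.card := by
    intro k
    have h2 := IsApproxCDT.gain_le (ht.1 k) (hC k) hσ
    have h3 := mul_le_mul_of_nonneg_left (Γ.frequency_le_card (ht.1 k) I) (ht.2.2.2.1 k).le
    linarith
  have hlim := ht.tendsto
  have h4 := ((Γ.continuous_utility.tendsto π).comp hlim).add
    (ht.2.2.2.2.mul_const (I.1.card : ℝ))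
  rw [zero_mul, add_zero] at h4
  exact le_of_tendsto_of_tendsto' (((Γ.continuous_cdtUtility I σ).tendsto π).comp hlim) h4 h1

/-! ### Nash outcomes exist and form a compact set -/

/-- The strategies in a closed set `E` that are realization-equivalent to a member of a compact
set `R` have a compact set of utilities. -/
lemma isCompact_outcomes {E R : (Γ.Infoset → A → ℝ) → Prop} (hE : IsClosed {π | E π})
    (hES : ∀ π, E π → Γ.IsStrategy π) (hR : IsCompact {π | R π}) :
    IsCompact {v | ∃ π, (E π ∧ ∃ π', R π' ∧ Γ.RealizationEquiv π π') ∧ Γ.utility π = v} := by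
  have hcl : IsClosed {q : (Γ.Infoset → A → ℝ) × (Γ.Infoset → A → ℝ) |
      Γ.RealizationEquiv q.1 q.2} := by
    simp only [RealizationEquiv, Set.ofPred_forall]
    exact isClosed_iInter fun h => isClosed_iInter fun _ =>
      isClosed_eq ((Γ.continuous_reachProb h).comp continuous_fst)
        ((Γ.continuous_reachProb h).comp continuous_snd)
  have hEc : IsCompact {π | E π} := Γ.isCompact_setOf_isStrategy.of_isClosed_subset hE hES
  convert ((hEc.prod hR).inter_right hcl).image (Γ.continuous_utility.comp continuous_fst) using 1
  ext v
  constructor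
  · rintro ⟨π, ⟨hπ, π', hπ', he⟩, rfl⟩
    exact ⟨(π, π'), ⟨⟨hπ, hπ'⟩, he⟩, rfl⟩
  · rintro ⟨⟨π, π'⟩, ⟨⟨hπ, hπ'⟩, he⟩, rfl⟩
    exact ⟨π, ⟨hπ, π', hπ', he⟩, rfl⟩

lemma isCompact_edtNashOutcomes : IsCompact Γ.edtNashOutcomes :=
  Γ.isCompact_outcomes (R := Γ.IsEDTRational) Γ.isClosed_setOf_isEDTEquilibrium
    (fun _ hπ => hπ.1)
    (Γ.isCompact_setOf_isTrembleLimit (C := Γ.IsApproxEDT) fun _ _ _ h hπ => hπ.mono h)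

lemma isCompact_cdtNashOutcomes : IsCompact Γ.cdtNashOutcomes :=
  Γ.isCompact_outcomes (R := Γ.IsCDTRational) Γ.isClosed_setOf_isCDTEquilibrium
    (fun _ hπ => hπ.1)
    (Γ.isCompact_setOf_isTrembleLimit (C := Γ.IsApproxCDT) fun _ _ _ h hπ => hπ.mono h)

lemma edtNashOutcomes_nonempty : Γ.edtNashOutcomes.Nonempty := by
  obtain ⟨π, hπ⟩ := Γ.exists_isTrembleLimit (C := Γ.IsApproxEDT) (fun _ _ _ h hπ => hπ.mono h)
    fun ε hε => by
      obtain ⟨π, h1, h2, h3, -⟩ := Γ.exists_isApproxEDT_isApproxCDT hε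
      exact ⟨π, h1, h2, h3⟩
  exact ⟨_, π, ⟨IsEDTRational.isEDTEquilibrium hπ, π, hπ, fun _ _ => rfl⟩, rfl⟩

lemma cdtNashOutcomes_nonempty : Γ.cdtNashOutcomes.Nonempty := by
  obtain ⟨π, hπ⟩ := Γ.exists_isTrembleLimit (C := Γ.IsApproxCDT) (fun _ _ _ h hπ => hπ.mono h)
    fun ε hε => by
      obtain ⟨π, h1, h2, -, h3⟩ := Γ.exists_isApproxEDT_isApproxCDT hε
      exact ⟨π, h1, h2, h3⟩
  exact ⟨_, π, ⟨IsCDTRational.isCDTEquilibrium hπ, π, hπ, fun _ _ => rfl⟩, rfl⟩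

theorem isOutcome_outcome (SC : SolutionConcept) : Γ.IsOutcome (Γ.outcome SC) SC := by
  cases SC
  · exact Γ.isCompact_cdtNashOutcomes.isLeast_sInf Γ.cdtNashOutcomes_nonempty
  · exact Γ.isCompact_cdtNashOutcomes.isGreatest_sSup Γ.cdtNashOutcomes_nonempty
  · exact Γ.isCompact_edtNashOutcomes.isLeast_sInf Γ.edtNashOutcomes_nonempty
  · exact Γ.isCompact_edtNashOutcomes.isGreatest_sSup Γ.edtNashOutcomes_nonempty

/-- The outcome of each solution concept is the utility of an equilibrium, hence of a strategy
equivalent to a CDT-rational or EDT-rational one. -/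
lemma exists_strategy_outcome (SC : SolutionConcept) : ∃ π π', Γ.IsStrategy π ∧
    Γ.utility π = Γ.outcome SC ∧ (Γ.IsCDTRational π' ∨ Γ.IsEDTRational π') ∧
    Γ.RealizationEquiv π π' := by
  have h := Γ.isOutcome_outcome SC
  cases SC
  all_goals
    obtain ⟨⟨π, ⟨hE, π', hR, he⟩, hU⟩, -⟩ := h
    exact ⟨π, π', hE.1, hU, by first | exact Or.inl hR | exact Or.inr hR, he⟩

/-! ### Observation sequences in the perfect recall refinement -/

lemma obsFrom_concat (h l : List A) (a : A) :
    Γ.obsFrom h (l ++ [a]) = Γ.obsFrom h l ++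
      if h ++ l ∈ Γ.decisionNodes then [(Γ.infosets.part (h ++ l), a)] else [] := by
  induction l generalizing h with
  | nil => simp [obsFrom]
  | cons b l ih =>
    simp only [List.cons_append, obsFrom, ih, List.append_assoc, List.nil_append]
    split_ifs <;> simp

lemma obs_concat_of_mem {h : List A} (hh : h ∈ Γ.decisionNodes) (a : A) :
    Γ.obs (h ++ [a]) = Γ.obs h ++ [(Γ.infosets.part h, a)] := by
  simp [obs, obsFrom_concat, hh]

lemma obs_concat_of_notMem {h : List A} (hh : h ∉ Γ.decisionNodes) (a : A) :
    Γ.obs (h ++ [a]) = Γ.obs h := by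
  simp [obs, obsFrom_concat, hh]

lemma length_obs_le_of_prefix {g h : List A} (hp : g <+: h) :
    (Γ.obs g).length ≤ (Γ.obs h).length := by
  obtain ⟨l, rfl⟩ := hp
  induction l using List.reverseRecOn with
  | nil => simp
  | append_singleton l a ih =>
    rw [← List.append_assoc]
    by_cases hd : g ++ l ∈ Γ.decisionNodes
    · rw [obs_concat_of_mem _ hd, List.length_append]; omega
    · rwa [obs_concat_of_notMem _ hd]

lemma mem_part_perfectRecall {g h : List A} :
    h ∈ Γ.perfectRecall.infosets.part g ↔ g ∈ Γ.decisionNodes ∧ h ∈ Γ.decisionNodes ∧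
      Γ.infosets.part g = Γ.infosets.part h ∧ Γ.obs g = Γ.obs h := by
  refine (Finpartition.mem_part_ofSetSetoid_iff_rel (s := Γ.recallSetoid) Γ.decisionNodes).trans ?_
  refine and_congr_right fun _ => and_congr_right fun _ => ?_
  exact Prod.ext_iff

lemma mem_infoset_perfectRecall {I : Γ.perfectRecall.Infoset} {g h : List A} (hg : g ∈ I.1)
    (hh : h ∈ I.1) : Γ.infosets.part g = Γ.infosets.part h ∧ Γ.obs g = Γ.obs h := by
  rw [← Γ.perfectRecall.infosets.part_eq_of_mem I.2 hg, mem_part_perfectRecall] at hh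
  exact hh.2.2

lemma infosetOf_perfectRecall_eq {g h : List A} (hg : g ∈ Γ.perfectRecall.decisionNodes)
    (hh : h ∈ Γ.perfectRecall.decisionNodes) (hp : Γ.infosets.part g = Γ.infosets.part h)
    (ho : Γ.obs g = Γ.obs h) :
    Γ.perfectRecall.infosetOf g hg = Γ.perfectRecall.infosetOf h hh := by
  rw [infosetOf_eq_iff]
  exact Γ.mem_part_perfectRecall.2 ⟨hh, hg, hp.symm, ho.symm⟩

/-- No infoset of the refinement contains a node and a proper ancestor of it. -/
lemma eq_of_prefix_of_mem_perfectRecall {I : Γ.perfectRecall.Infoset} {g h : List A}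
    (hg : g ∈ I.1) (hh : h ∈ I.1) (hp : g <+: h) : g = h := by
  obtain ⟨l, rfl⟩ := hp
  cases l with
  | nil => simp
  | cons a l =>
    exfalso
    have h1 : Γ.obs g = Γ.obs (g ++ a :: l) := (Γ.mem_infoset_perfectRecall hg hh).2
    have h2 : (Γ.obs (g ++ [a])).length ≤ (Γ.obs (g ++ a :: l)).length :=
      Γ.length_obs_le_of_prefix ⟨l, by simp⟩
    rw [← h1, Γ.obs_concat_of_mem (Γ.perfectRecall.infoset_subset I hg)] at h2
    simp at h2

lemma firstNodes_perfectRecall (I : Γ.perfectRecall.Infoset) :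
    Γ.perfectRecall.firstNodes I = I.1 :=
  Finset.filter_true_of_mem fun _ hh _ hg hp => Γ.eq_of_prefix_of_mem_perfectRecall hg hh hp

/-! ### Likelihood ratios -/

/-- The ratio of the probabilities of the action `a` at the node `h` under `τ` and under `π`. -/
noncomputable def stepRatio (τ π : Γ.Infoset → A → ℝ) (h : List A) (a : A) : ℝ :=
  if hh : h ∈ Γ.decisionNodes then τ (Γ.infosetOf h hh) a / π (Γ.infosetOf h hh) a else 1

/-- The product of the ratios `stepRatio` along the actions `l` from the node `h` on. -/
noncomputable def ratioFrom (τ π : Γ.Infoset → A → ℝ) : List A → List A → ℝ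
  | _, [] => 1
  | h, a :: l => Γ.stepRatio τ π h a * ratioFrom τ π (h ++ [a]) l

lemma ratioFrom_concat (τ π : Γ.Infoset → A → ℝ) (h l : List A) (a : A) :
    Γ.ratioFrom τ π h (l ++ [a]) = Γ.ratioFrom τ π h l * Γ.stepRatio τ π (h ++ l) a := by
  induction l generalizing h with
  | nil => simp [ratioFrom]
  | cons b l ih => simp [ratioFrom, ih, mul_assoc]

/-- The likelihood ratio of the node `h` under `τ` and under `π`: the contributions of chance
cancel. -/
noncomputable def likelihoodRatio (τ π : Γ.Infoset → A → ℝ) (h : List A) : ℝ :=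
  Γ.ratioFrom τ π [] h

lemma likelihoodRatio_concat (τ π : Γ.Infoset → A → ℝ) (h : List A) (a : A) :
    Γ.likelihoodRatio τ π (h ++ [a]) = Γ.likelihoodRatio τ π h * Γ.stepRatio τ π h a := by
  simp [likelihoodRatio, ratioFrom_concat]

lemma likelihoodRatio_nonneg {τ π : Γ.Infoset → A → ℝ} (hτ : Γ.IsStrategy τ)
    (hπ : Γ.IsStrategy π) (h : List A) : 0 ≤ Γ.likelihoodRatio τ π h := by
  induction h using List.reverseRecOn with
  | nil => exact zero_le_one
  | append_singleton h a ih =>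
    rw [likelihoodRatio_concat]
    refine mul_nonneg ih ?_
    unfold stepRatio
    split_ifs
    · exact div_nonneg ((hτ _).1 a) ((hπ _).1 a)
    · exact zero_le_one

lemma reachProb_eq_likelihoodRatio_mul (τ : Γ.Infoset → A → ℝ) {π : Γ.Infoset → A → ℝ}
    (hmix : Γ.IsFullyMixed π) {h : List A} (hh : h ∈ Γ.nodes) :
    Γ.reachProb τ h = Γ.likelihoodRatio τ π h * Γ.reachProb π h := by
  induction h using List.reverseRecOn with
  | nil => simp [likelihoodRatio, ratioFrom, reachProb_nil]
  | append_singleton h a ih =>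
    have hstep : Γ.stepProb τ h a = Γ.stepRatio τ π h a * Γ.stepProb π h a := by
      unfold stepProb stepRatio
      split_ifs with hd
      · refine (div_mul_cancel₀ _ (hmix _ a ?_).ne').symm
        rw [Γ.actionsAt_eq ((Γ.infosetOf_eq_iff hd).1 rfl)]
        exact Γ.mem_actions.2 hh
      · rw [one_mul]
    rw [reachProb_concat, reachProb_concat, likelihoodRatio_concat,
      ih (Γ.prefix_closed _ _ hh), hstep]
    ring

/-- In the refinement the likelihood ratio of a node depends only on its observation
sequence. -/
lemma likelihoodRatio_perfectRecall (τ π : Γ.perfectRecall.Infoset → A → ℝ) (g h : List A)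
    (ho : Γ.obs g = Γ.obs h) :
    Γ.perfectRecall.likelihoodRatio τ π g = Γ.perfectRecall.likelihoodRatio τ π h := by
  -- a chance move contributes neither to the ratio nor to the observation sequence
  have chance : ∀ (k : List A) (a : A), k ∉ Γ.decisionNodes →
      Γ.perfectRecall.likelihoodRatio τ π (k ++ [a]) =
        Γ.perfectRecall.likelihoodRatio τ π k := by
    intro k a hk
    have hk' : k ∉ Γ.perfectRecall.decisionNodes := hk
    rw [likelihoodRatio_concat, stepRatio, dif_neg hk', mul_one]
  induction hn : g.length + h.length using Nat.strong_induction_on generalizing g h with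
  | _ n ih =>
    rcases List.eq_nil_or_concat' g with rfl | ⟨g, a, rfl⟩
    · rcases List.eq_nil_or_concat' h with rfl | ⟨h, b, rfl⟩
      · rfl
      · by_cases hd : h ∈ Γ.decisionNodes
        · rw [obs_concat_of_mem _ hd] at ho
          simp [obs, obsFrom] at ho
        · rw [obs_concat_of_notMem _ hd] at ho
          rw [chance h b hd]
          exact ih _ (by simp at hn ⊢; omega) _ _ ho rfl
    · by_cases hg : g ∈ Γ.decisionNodes
      · rcases List.eq_nil_or_concat' h with rfl | ⟨h, b, rfl⟩
        · rw [obs_concat_of_mem _ hg] at ho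
          simp [obs, obsFrom] at ho
        · by_cases hd : h ∈ Γ.decisionNodes
          · rw [obs_concat_of_mem _ hg, obs_concat_of_mem _ hd] at ho
            obtain ⟨ho', hpa⟩ := List.append_inj' ho rfl
            simp only [List.cons.injEq, Prod.mk.injEq, and_true] at hpa
            obtain ⟨hp, rfl⟩ := hpa
            have hg' : g ∈ Γ.perfectRecall.decisionNodes := hg
            have hd' : h ∈ Γ.perfectRecall.decisionNodes := hd
            rw [likelihoodRatio_concat, likelihoodRatio_concat,
              ih _ (by simp at hn ⊢; omega) _ _ ho' rfl, stepRatio, stepRatio, dif_pos hg',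
              dif_pos hd', Γ.infosetOf_perfectRecall_eq hg' hd' hp ho']
          · rw [obs_concat_of_notMem _ hd] at ho
            rw [chance h b hd]
            exact ih _ (by simp at hn ⊢; omega) _ _ ho rfl
      · rw [obs_concat_of_notMem _ hg] at ho
        rw [chance g a hg]
        exact ih _ (by simp at hn ⊢; omega) _ _ ho rfl

/-! ### Local optimality is global optimality under perfect recall -/

/-- Under perfect recall, first-order gains that are small relative to the visit frequencies under
a fully mixed strategy `π` add up to a small global gain: passing from `π` to `τ` multiplies the
reach probabilities of all nodes of an infoset by the same factor. -/
lemma utility_sub_le_perfectRecall {π τ : Γ.perfectRecall.Infoset → A → ℝ} {ε : ℝ} (hε : 0 ≤ ε)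
    (hπ : Γ.perfectRecall.IsStrategy π) (hmix : Γ.perfectRecall.IsFullyMixed π)
    (hgain : ∀ I σ, Γ.perfectRecall.IsRandomizedAction I σ →
      Γ.perfectRecall.cdtUtility σ π I - Γ.perfectRecall.utility π ≤
        ε * Γ.perfectRecall.frequency π I)
    (hτ : Γ.perfectRecall.IsStrategy τ) :
    Γ.perfectRecall.utility τ - Γ.perfectRecall.utility π ≤
      ε * Γ.perfectRecall.decisionNodes.card := by
  rw [utility_sub]
  have hcard : (Γ.perfectRecall.decisionNodes.card : ℝ) =
      ∑ h ∈ Γ.perfectRecall.decisionNodes, 1 := by simp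
  rw [hcard, sum_decisionNodes, sum_decisionNodes, Finset.mul_sum]
  refine Finset.sum_le_sum fun I _ => ?_
  obtain ⟨h₀, hh₀⟩ := Γ.perfectRecall.infoset_nonempty I
  set c := Γ.perfectRecall.likelihoodRatio τ π h₀ with hc
  have hc0 : 0 ≤ c := Γ.perfectRecall.likelihoodRatio_nonneg hτ hπ h₀
  have hreach : ∀ h ∈ I.1,
      Γ.perfectRecall.reachProb τ h = c * Γ.perfectRecall.reachProb π h := by
    intro h hh
    rw [Γ.perfectRecall.reachProb_eq_likelihoodRatio_mul τ hmix
      (Γ.perfectRecall.mem_nodes_of_mem_infoset hh),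
      Γ.likelihoodRatio_perfectRecall τ π h h₀ (Γ.mem_infoset_perfectRecall hh hh₀).2]
  have h1 : (∑ h ∈ I.1, Γ.perfectRecall.reachProb τ h *
      ∑ a ∈ Γ.perfectRecall.actions h, (Γ.perfectRecall.stepProb τ h a -
        Γ.perfectRecall.stepProb π h a) * Γ.perfectRecall.valueFrom π (h ++ [a])) =
      c * (Γ.perfectRecall.cdtUtility (τ I) π I - Γ.perfectRecall.utility π) := by
    rw [cdtUtility_sub, Finset.mul_sum]
    refine Finset.sum_congr rfl fun h hh => ?_
    rw [hreach h hh, Γ.perfectRecall.actionsAt_eq hh, mul_assoc]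
    simp only [Γ.perfectRecall.stepProb_of_mem _ hh]
  have h2 : c * Γ.perfectRecall.frequency π I = Γ.perfectRecall.frequency τ I := by
    rw [frequency, frequency, Finset.mul_sum]
    exact Finset.sum_congr rfl fun h hh => (hreach h hh).symm
  have h3 := mul_le_mul_of_nonneg_left (hgain I (τ I) (hτ I)) hc0
  have h4 := mul_le_mul_of_nonneg_left (Γ.perfectRecall.frequency_le_card hτ I) hε
  rw [h1]
  simp only [Finset.sum_const, nsmul_eq_mul, mul_one]
  calc _ ≤ c * (ε * Γ.perfectRecall.frequency π I) := h3
    _ = ε * Γ.perfectRecall.frequency τ I := by rw [← h2]; ring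
    _ ≤ _ := h4

/-- Without repeated visits the utility is affine in the randomized action at each infoset, so
that the EDT and CDT gains agree. -/
lemma utility_deviate_perfectRecall (π : Γ.perfectRecall.Infoset → A → ℝ)
    (I : Γ.perfectRecall.Infoset) (σ : A → ℝ) :
    Γ.perfectRecall.utility (Γ.perfectRecall.deviate π I σ) =
      Γ.perfectRecall.cdtUtility σ π I := by
  rw [← sub_left_inj (a := Γ.perfectRecall.utility π), utility_deviate_sub, cdtUtility_sub]
  refine Finset.sum_congr rfl fun h hh => ?_
  rw [Γ.perfectRecall.reachProb_deviate π I σ h fun g hg hp =>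
    Γ.eq_of_prefix_of_mem_perfectRecall hg hh hp]

lemma infosetProb_perfectRecall (π : Γ.perfectRecall.Infoset → A → ℝ)
    (I : Γ.perfectRecall.Infoset) :
    Γ.perfectRecall.infosetProb π I = Γ.perfectRecall.frequency π I := by
  rw [infosetProb, firstNodes_perfectRecall, frequency]

lemma isApproxEDT_perfectRecall_iff (ε : ℝ) (π : Γ.perfectRecall.Infoset → A → ℝ) :
    Γ.perfectRecall.IsApproxEDT ε π ↔ Γ.perfectRecall.IsApproxCDT ε π := by
  simp only [IsApproxEDT, IsApproxCDT, infosetProb_perfectRecall, utility_deviate_perfectRecall]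

lemma utility_le_of_isCDTRational_perfectRecall {π τ : Γ.perfectRecall.Infoset → A → ℝ}
    (h : Γ.perfectRecall.IsCDTRational π) (hτ : Γ.perfectRecall.IsStrategy τ) :
    Γ.perfectRecall.utility τ ≤ Γ.perfectRecall.utility π := by
  obtain ⟨-, p, ε, ht, hC⟩ := h
  have h1 : ∀ k, Γ.perfectRecall.utility τ ≤ Γ.perfectRecall.utility (p k) +
      ε k * Γ.perfectRecall.decisionNodes.card := fun k => by
    have := Γ.utility_sub_le_perfectRecall (ht.2.2.2.1 k).le (ht.1 k) (ht.2.1 k)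
      (fun I σ hσ => IsApproxCDT.gain_le (ht.1 k) (hC k) hσ) hτ
    linarith
  have h2 := ((Γ.perfectRecall.continuous_utility.tendsto π).comp ht.tendsto).add
    (ht.2.2.2.2.mul_const (Γ.perfectRecall.decisionNodes.card : ℝ))
  rw [zero_mul, add_zero] at h2
  exact ge_of_tendsto' h2 h1

lemma isCDTRational_of_isEDTRational_perfectRecall {π : Γ.perfectRecall.Infoset → A → ℝ}
    (h : Γ.perfectRecall.IsEDTRational π) : Γ.perfectRecall.IsCDTRational π := by
  obtain ⟨hπ, p, ε, ht, hC⟩ := h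
  exact ⟨hπ, p, ε, ht, fun k => (Γ.isApproxEDT_perfectRecall_iff _ _).1 (hC k)⟩

lemma utility_eq_of_realizationEquiv {π π' : Γ.Infoset → A → ℝ}
    (h : Γ.RealizationEquiv π π') : Γ.utility π = Γ.utility π' :=
  Finset.sum_congr rfl fun z hz => by rw [h z (Γ.mem_nodes_of_mem_terminals hz)]

/-- Every outcome of the refinement is the largest utility of any strategy. -/
lemma utility_le_outcome_perfectRecall (SC : SolutionConcept)
    {τ : Γ.perfectRecall.Infoset → A → ℝ} (hτ : Γ.perfectRecall.IsStrategy τ) :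
    Γ.perfectRecall.utility τ ≤ Γ.perfectRecall.outcome SC := by
  obtain ⟨π, π', -, hU, hR, he⟩ := Γ.perfectRecall.exists_strategy_outcome SC
  rw [← hU, Γ.perfectRecall.utility_eq_of_realizationEquiv he]
  refine Γ.utility_le_of_isCDTRational_perfectRecall (hR.elim id ?_) hτ
  exact Γ.isCDTRational_of_isEDTRational_perfectRecall

/-! ### Strategies of the game are strategies of its refinement -/

/-- The infoset of the game that contains a given infoset of the refinement. -/
lemma exists_infoset_superset (I : Γ.perfectRecall.Infoset) : ∃ J : Γ.Infoset, I.1 ⊆ J.1 := by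
  obtain ⟨g, hg⟩ := Γ.perfectRecall.infoset_nonempty I
  have hgd : g ∈ Γ.decisionNodes := Γ.perfectRecall.infoset_subset I hg
  refine ⟨Γ.infosetOf g hgd, fun h hh => ?_⟩
  have hhd : h ∈ Γ.decisionNodes := Γ.perfectRecall.infoset_subset I hh
  change h ∈ Γ.infosets.part g
  rw [(Γ.mem_infoset_perfectRecall hg hh).1]
  exact Γ.infosets.mem_part hhd

lemma exists_strategy_perfectRecall {π : Γ.Infoset → A → ℝ} (hπ : Γ.IsStrategy π) :
    ∃ τ, Γ.perfectRecall.IsStrategy τ ∧ Γ.perfectRecall.utility τ = Γ.utility π := by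
  choose J hJ using Γ.exists_infoset_superset
  refine ⟨fun I => π (J I), fun I => ?_, ?_⟩
  · obtain ⟨h, hh⟩ := Γ.perfectRecall.infoset_nonempty I
    have hA : Γ.perfectRecall.actionsAt I = Γ.actionsAt (J I) := by
      rw [Γ.perfectRecall.actionsAt_eq hh, Γ.actionsAt_eq (hJ I hh)]
      rfl
    have := hπ (J I)
    rw [IsRandomizedAction, ← hA] at this
    exact this
  · have hstep : ∀ h a, Γ.perfectRecall.stepProb (fun I => π (J I)) h a = Γ.stepProb π h a := by
      intro h a
      by_cases hd : h ∈ Γ.decisionNodes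
      · have hd' : h ∈ Γ.perfectRecall.decisionNodes := hd
        rw [Γ.stepProb_of_mem π (hJ (Γ.perfectRecall.infosetOf h hd')
          ((Γ.perfectRecall.infosetOf_eq_iff hd').1 rfl)), stepProb, dif_pos hd']
      · have hd' : h ∉ Γ.perfectRecall.decisionNodes := hd
        rw [stepProb, stepProb, dif_neg hd, dif_neg hd']
        rfl
    have hprob : ∀ l h, Γ.perfectRecall.probFrom (fun I => π (J I)) h l = Γ.probFrom π h l := by
      intro l
      induction l with
      | nil => intro h; rfl
      | cons a l ih => intro h; rw [probFrom, probFrom, hstep, ih]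
    exact Finset.sum_congr rfl fun z _ => congrArg (· * Γ.payoff z) (hprob z [])

theorem outcome_le_outcome_perfectRecall (SC : SolutionConcept) :
    Γ.outcome SC ≤ Γ.perfectRecall.outcome SC := by
  obtain ⟨π, -, hπ, hU, -⟩ := Γ.exists_strategy_outcome SC
  obtain ⟨τ, hτ, hτU⟩ := Γ.exists_strategy_perfectRecall hπ
  rw [← hU, ← hτU]
  exact Γ.utility_le_outcome_perfectRecall SC hτ

lemma outcome_nonneg (SC : SolutionConcept) : 0 ≤ Γ.outcome SC := by
  obtain ⟨π, -, hπ, hU, -⟩ := Γ.exists_strategy_outcome SC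
  rw [← hU]
  exact Γ.utility_nonneg hπ

end SinglePlayerGame

theorem mainTheorem10 {A : Type u} [DecidableEq A] (Γ : SinglePlayerGame A)
    (SC : SolutionConcept) :
    Γ.IsOutcome (Γ.outcome SC) SC ∧
    Γ.perfectRecall.IsOutcome (Γ.perfectRecall.outcome SC) SC ∧
    Γ.outcome SC ≤ Γ.perfectRecall.outcome SC ∧
    (¬ (Γ.perfectRecall.outcome SC = 0 ∧ Γ.outcome SC = 0) → 1 ≤ Γ.valueOfRecall SC) := by
  have hle := Γ.outcome_le_outcome_perfectRecall SC
  have h0 := Γ.outcome_nonneg SC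
  refine ⟨Γ.isOutcome_outcome SC, Γ.perfectRecall.isOutcome_outcome SC, hle, fun hne => ?_⟩
  have hpos : 0 < Γ.perfectRecall.outcome SC := by
    refine lt_of_le_of_ne (h0.trans hle) fun h => hne ⟨h.symm, ?_⟩
    exact le_antisymm (hle.trans h.symm.le) h0
  rw [SinglePlayerGame.valueOfRecall, ENNReal.le_div_iff_mul_le
    (Or.inr (ENNReal.ofReal_pos.2 hpos).ne') (Or.inl ENNReal.ofReal_ne_top), one_mul]
  exact ENNReal.ofReal_le_ofReal hle
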